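/- Let $n\in\mathbb N$ and let $M\in\mathbb R^{n\times n}$ be a stochastic matrix ($M_{ij}\ge 0$, $\sum_j M_{ij}=1$) that is primitive (some power of $M$ has only strictly positive entries). Let $p=(p_1,\dots,p_n)$ be its stationary probability vector ($pM=p$, $p_i\geq 0$, $\sum_i p_i=1$; then all $p_i>0$), and assume that $M$ is reversible, i.e. $\Pi M=M^t\,\Pi$ with $\Pi=\mathrm{diag}(p_1,\dots,p_n)$. Put $P=\mathrm{diag}(\sqrt{p_1},\dots,\sqrt{p_n})$, $S=PMP^{-1}$, $S_0=|b_1\rangle\langle b_1|=(\sqrt{p_ip_j})_{i,j}$ with $b_1=(\sqrt{p_1},\dots,\sqrt{p_n})$ the normalised eigenvector of the symmetric matrix $S$ for the eigenvalue $1$, and $S_1=S-S_0$. Let $h=(h_1,\dots,h_n)$ consist of pairwise different complex numbers, and put $\langle h\rangle=\sum_i p_ih_i$. Let $(\eta(m))_{m\in\mathbb Z}$ be the stationary Markov process with values in $\{h_1,\dots,h_n\}$ defined by $M$ and $p$, i.e. $\mathbb P(\eta(a)=h_{i_0},\dots,\eta(a+l)=h_{i_l})=p_{i_0}M_{i_0i_1}\cdots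 M_{i_{l-1}i_l}$ for all $a\in\mathbb Z$, $l\ge 0$ and all indices $i_0,\dots,i_l$, and let $\omega=\sum_{m\in\mathbb Z}\eta(m)\,\delta_m$ be the corresponding stochastic Dirac comb on $\mathbb R$. For $R>0$ let $\omega_R$ be the restriction of $\omega$ to $B_R=[-R,R]$ and let $\gamma^R=\frac{1}{2R}\,\omega_R*\widetilde{\omega_R}$, where $\widetilde\mu(g)=\overline{\mu(\widetilde g)}$ and $\widetilde g(x)=\overline{g(-x)}$. **Theorem.** With probability one, the vague limit $\gamma_\omega=\lim_{R\to\infty}\gamma^R$ (the natural autocorrelation of $\omega$) exists and is a tempered measure, and its Fourier transform $\hat\gamma_\omega$ (the diffraction measure of $\omega$; in the sense of tempered distributions, $\hat T(\phi)=T(\hat\phi)$ with $\hat\phi(k)=\int_{\mathbb R} e^{-2\pi i kx}\phi(x)\,dx$) is a positive measure, given by $$\hat\gamma_\omega=|\langle h\rangle|^2\sum_{k\in\mathbb Z}\delta_k+(\hat\gamma_\omega)_{ac}.$$ The absolutely continuous part $(\hat\gamma_\omega)_{ac}$ has as its density with respect to Lebesgue measure the $\mathbb Z$-periodic, continuous (hence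 bounded), non-negative function $$f(k)=\Big\langle h\,\Big|\,P\,\frac{1-S_1^2}{1-2\cos(2\pi k)S_1+S_1^2}\,P\,\Big|\,h\Big\rangle-|\langle h\rangle|^2,$$ where $\langle u|A|v\rangle=\sum_{i,j}\overline{u_i}A_{ij}v_j$, and where the denominator is an invertible matrix for every $k\in\mathbb R$ and commutes with the numerator. -/

import Mathlib

open MeasureTheory Filter Topology Matrix
open scoped SchwartzMap CompactlySupported FourierTransform ComplexConjugate

noncomputable section

namespace Diffraction

/-- The Dirac comb `∑_{m ∈ ℤ} δ_m` of the integer lattice, a positive measure on `ℝ`. -/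
def integerComb : Measure ℝ := Measure.sum fun m : ℤ => Measure.dirac (m : ℝ)

instance instIntegerCombLocallyFinite : IsLocallyFiniteMeasure integerComb := by
  refine ⟨fun x => ⟨Metric.ball x 1, Metric.ball_mem_nhds x one_pos, ?_⟩⟩
  have hfin : ((fun m : ℤ => (m : ℝ)) ⁻¹' Metric.ball x 1).Finite := by
    refine (Set.finite_Icc ⌊x - 1⌋ ⌈x + 1⌉).subset fun m hm => ?_
    rw [Set.mem_preimage, Real.ball_eq_Ioo] at hm
    constructor
    · exact_mod_cast (Int.floor_le (x - 1)).trans hm.1.le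
    · exact_mod_cast hm.2.le.trans (Int.le_ceil (x + 1))
  rw [integerComb, Measure.sum_apply _ measurableSet_ball,
    tsum_eq_sum (s := hfin.toFinset) ?_]
  · refine ENNReal.sum_lt_top.2 fun m _ => measure_lt_top _ _
  · intro m hm
    rw [Measure.dirac_apply' _ measurableSet_ball]
    exact Set.indicator_of_notMem (by simpa using hm) _

/-- A (possibly unbounded) complex measure on `ℝ`, presented as `density · base` where `base` is a
positive, locally finite Borel measure and `density` is locally integrable with respect to it.
By the polar decomposition `μ = (dμ/d|μ|) · |μ|`, every complex Radon measure on `ℝ` is of this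
form. Two presentations give the same measure if they have the same values `μ(f)`, see
`CMeasure.eval`, on all `f ∈ C_c(ℝ, ℂ)`. -/
structure CMeasure where
  base : Measure ℝ
  locallyFinite : IsLocallyFiniteMeasure base
  density : ℝ → ℂ
  locallyIntegrable : LocallyIntegrable density base

namespace CMeasure

/-- The value `μ(f) = ∫ f dμ` of the measure `μ` on the function `f`. -/
def eval (μ : CMeasure) (f : ℝ → ℂ) : ℂ := ∫ x, f x * μ.density x ∂μ.base

/-- The restriction `μ_R` of `μ` to the closed ball of radius `R` with centre `0`. -/
def restrictBall (μ : CMeasure) (R : ℝ) : CMeasure where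
  base := μ.base.restrict (Metric.closedBall 0 R)
  locallyFinite := by
    have := μ.locallyFinite
    infer_instance
  density := μ.density
  locallyIntegrable := fun x => (μ.locallyIntegrable x).mono_measure Measure.restrict_le_self

/-- The measure `μ̃`, given by `μ̃(f) = conj (μ(f̃))` where `f̃(x) = conj (f(-x))`. -/
def tilde (μ : CMeasure) : CMeasure where
  base := μ.base.map (fun x => -x)
  locallyFinite := by
    have := μ.locallyFinite
    refine ⟨fun x => ?_⟩
    obtain ⟨s, hs, hμ⟩ := μ.base.finiteAt_nhds (-x)
    refine ⟨(fun y : ℝ => -y) ⁻¹' s, continuous_neg.continuousAt hs, ?_⟩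
    have h := (Homeomorph.neg ℝ).toMeasurableEquiv.map_apply (μ := μ.base)
      ((fun y : ℝ => -y) ⁻¹' s)
    have h2 : (fun y : ℝ => -y) ⁻¹' ((fun y : ℝ => -y) ⁻¹' s) = s := by
      ext y
      simp
    calc _ = μ.base ((fun y : ℝ => -y) ⁻¹' ((fun y : ℝ => -y) ⁻¹' s)) := h
      _ = μ.base s := by rw [h2]
      _ < ⊤ := hμ
  density := fun x => conj (μ.density (-x))
  locallyIntegrable := by
    intro x
    obtain ⟨s, hs, hi⟩ := μ.locallyIntegrable (-x)
    refine ⟨(fun y : ℝ => -y) ⁻¹' s, continuous_neg.continuousAt hs, ?_⟩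
    have hemb : MeasurableEmbedding (fun y : ℝ => -y) :=
      (Homeomorph.neg ℝ).measurableEmbedding
    rw [hemb.integrableOn_map_iff]
    have h2 : (fun y : ℝ => -y) ⁻¹' ((fun y : ℝ => -y) ⁻¹' s) = s := by
      ext y
      simp
    rw [h2]
    have h3 : (fun x => conj (μ.density (-x))) ∘ (fun y : ℝ => -y) =
        fun y => conj (μ.density y) := by
      ext y
      simp
    rw [h3]
    exact (Complex.conjLIE.toContinuousLinearEquiv.toContinuousLinearMap).integrable_comp hi

/-- The value `(μ * ν)(f) = ∫∫ f(x + y) dμ(x) dν(y)` of the convolution. -/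
def convEval (μ ν : CMeasure) (f : ℝ → ℂ) : ℂ := μ.eval fun x => ν.eval fun y => f (x + y)

/-- The value on `f` of `γ^R = vol(B_R)⁻¹ (μ_R * (μ_R)~)`. -/
def approxAutocorrelation (μ : CMeasure) (R : ℝ) (f : ℝ → ℂ) : ℂ :=
  ((volume (Metric.closedBall (0 : ℝ) R)).toReal : ℂ)⁻¹ *
    convEval (μ.restrictBall R) (μ.restrictBall R).tilde f

/-- `γ` is the natural autocorrelation of `μ`: the measures `γ^R` converge vaguely to `γ` as
`R → ∞` (so `γ` is the only vague point of accumulation). -/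
def IsNaturalAutocorrelation (μ γ : CMeasure) : Prop :=
  ∀ f : C_c(ℝ, ℂ), Tendsto (fun R : ℝ => μ.approxAutocorrelation R f) atTop (𝓝 (γ.eval f))

/-- `μ` is a tempered measure, with associated tempered distribution `T`. -/
def Represents (μ : CMeasure) (T : 𝓢'(ℝ, ℂ)) : Prop :=
  ∀ φ : 𝓢(ℝ, ℂ), Integrable (fun x => φ x * μ.density x) μ.base ∧ T φ = μ.eval φ

/-- A positive, locally finite measure as a complex measure. -/
def ofMeasure (ρ : Measure ℝ) [hρ : IsLocallyFiniteMeasure ρ] : CMeasure where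
  base := ρ
  locallyFinite := hρ
  density := fun _ => 1
  locallyIntegrable := locallyIntegrable_const 1

/-- The positive measure `ρ` is the diffraction measure of `μ`: the natural autocorrelation `γ` of
`μ` exists, is a tempered measure, and its Fourier transform, in the sense of tempered
distributions and with kernel `exp (-2πikx)`, is the measure `ρ`. -/
def IsDiffraction (μ : CMeasure) (ρ : Measure ℝ) : Prop :=
  ∃ (_ : IsLocallyFiniteMeasure ρ) (γ : CMeasure) (T : 𝓢'(ℝ, ℂ)),
    μ.IsNaturalAutocorrelation γ ∧ γ.Represents T ∧ (ofMeasure ρ).Represents (𝓕 T)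

/-- The weighted Dirac comb `∑_{m ∈ ℤ} w(m) δ_m`. The measure `integerComb` is carried by `ℤ`, and
the density takes the value `w m` at the integer `m`. -/
def weightedComb (w : ℤ → ℂ) : CMeasure where
  base := integerComb
  locallyFinite := inferInstance
  density := fun x => w ⌊x⌋
  locallyIntegrable := by
    have hm : Measurable fun x : ℝ => w ⌊x⌋ := (measurable_of_countable w).comp Int.measurable_floor
    refine fun x => ⟨Metric.ball x 1, Metric.ball_mem_nhds x one_pos, ?_⟩
    have hb : BddAbove ((fun m : ℤ => ‖w m‖) '' Set.Icc ⌊x - 1⌋ ⌊x + 1⌋) :=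
      ((Set.finite_Icc _ _).image _).bddAbove
    obtain ⟨C, hC⟩ := hb
    refine Measure.integrableOn_of_bounded (M := C) ?_ hm.aestronglyMeasurable ?_
    · exact ((measure_mono Metric.ball_subset_closedBall).trans_lt
        (isCompact_closedBall x 1).measure_lt_top).ne
    · refine (ae_restrict_mem measurableSet_ball).mono fun y hy => ?_
      rw [Real.ball_eq_Ioo] at hy
      exact hC ⟨⌊y⌋, ⟨Int.floor_mono hy.1.le, Int.floor_mono hy.2.le⟩, rfl⟩

end CMeasure

/-- The absolutely continuous part, with respect to Lebesgue measure, of a measure on `ℝ`. -/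
def acPart (ρ : Measure ℝ) : Measure ℝ := volume.withDensity (ρ.rnDeriv volume)

/-- The two-sided stationary Markov process with states `h 0, …, h (n-1)`, transition matrix `M` and
stationary vector `p`, given by the probabilities of all cylinder sets:
`P(η_a = h_{i_0}, …, η_{a+l} = h_{i_l}) = p_{i_0} M_{i_0 i_1} ⋯ M_{i_{l-1} i_l}`. -/
structure IsStationaryMarkovProcess {Ω : Type*} [MeasurableSpace Ω] (P : Measure Ω) {n : ℕ}
    (h : Fin n → ℂ) (M : Matrix (Fin n) (Fin n) ℝ) (p : Fin n → ℝ) (η : ℤ → Ω → ℂ) : Prop where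
  measurable : ∀ m, Measurable (η m)
  cylinder : ∀ (a : ℤ) (l : ℕ) (i : Fin (l + 1) → Fin n),
    P {ω | ∀ j : Fin (l + 1), η (a + (j : ℕ)) ω = h (i j)} =
      ENNReal.ofReal (p (i 0) * ∏ j : Fin l, M (i j.castSucc) (i j.succ))

section Matrices

variable {n : ℕ}

/-- `P = diag(√p_1, …, √p_n)`. -/
def sqrtDiag (p : Fin n → ℝ) : Matrix (Fin n) (Fin n) ℝ := diagonal fun i => √(p i)

/-- `S = P M P⁻¹`. -/
def symMatrix (M : Matrix (Fin n) (Fin n) ℝ) (p : Fin n → ℝ) : Matrix (Fin n) (Fin n) ℝ :=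
  sqrtDiag p * M * (sqrtDiag p)⁻¹

/-- The normalised eigenvector `b_1 = (√p_1, …, √p_n)` of `S` for the eigenvalue `1`. -/
def leadingVector (p : Fin n → ℝ) : Fin n → ℝ := fun i => √(p i)

/-- `S_1 = S - S_0`, where `S_0 = |b_1⟩⟨b_1| = (√(p_i p_j))` is the projector on `b_1`. -/
def contraction (M : Matrix (Fin n) (Fin n) ℝ) (p : Fin n → ℝ) : Matrix (Fin n) (Fin n) ℝ :=
  symMatrix M p - vecMulVec (leadingVector p) (leadingVector p)

/-- The denominator `1 - 2 cos(2πk) S_1 + S_1²`. -/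
def denominator (M : Matrix (Fin n) (Fin n) ℝ) (p : Fin n → ℝ) (k : ℝ) :
    Matrix (Fin n) (Fin n) ℝ :=
  1 - (2 * Real.cos (2 * Real.pi * k)) • contraction M p + contraction M p ^ 2

/-- `⟨h|A|h⟩ = ∑_{i,j} conj(h_i) A_{ij} h_j` for a real matrix `A` and a complex vector `h`. -/
def braket (h : Fin n → ℂ) (A : Matrix (Fin n) (Fin n) ℝ) : ℂ :=
  ∑ i, ∑ j, conj (h i) * (A i j : ℂ) * h j

/-- The mean scattering strength `⟨h⟩ = ∑ p_i h_i`. -/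
def mean (p : Fin n → ℝ) (h : Fin n → ℂ) : ℂ := ∑ i, (p i : ℂ) * h i

/-- `⟨h| P (1 - S_1²)/(1 - 2 cos(2πk) S_1 + S_1²) P |h⟩ - |⟨h⟩|²`. The two matrices in the quotient
commute. -/
def diffuseFormula (M : Matrix (Fin n) (Fin n) ℝ) (p : Fin n → ℝ) (h : Fin n → ℂ) (k : ℝ) : ℂ :=
  braket h (sqrtDiag p * ((1 - contraction M p ^ 2) * (denominator M p k)⁻¹) * sqrtDiag p) -
    ((‖mean p h‖ ^ 2 : ℝ) : ℂ)

end Matrices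

end Diffraction

end

noncomputable section

namespace Diffraction

/-! ### Integration against the integer comb -/

/-! The autocorrelation of a comb on the integers is again such a comb. Its coefficient at `m` is
the limit of averages of `η (k + m) * conj (η k)` over long windows, so everything reduces to these
limits and their Fourier series.

Probability. The eigenvalues of `S_1` lie in `(-1, 1)`: an eigenvector of modulus at least one would
give an eigenvector of `M` that is constant by primitivity, yet orthogonal to `p`. Hence `M ^ s`
tends to its limit geometrically, the Markov property makes the products above exponentially
decorrelated (`exists_norm_integral_lagDeviation_le`), and the variance of their sums grows
linearly. A strong law follows by convergence along squares plus bounded increments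
(`ae_tendsto_inv_mul`). The limit is the expectation `c m`.

Fourier analysis. For `m ≠ 0`, `S ^ |m| = S_0 + S_1 ^ |m|` splits `c m` into the constant `|⟨h⟩|²`
and a summable remainder. Poisson summation turns the constant into the Dirac comb. The remainder is
the Fourier series of a continuous function, which in an eigenbasis of `S_1` is a sum of Poisson
kernels; the quotient in the diffuse formula is its matrix form. At `m = 0` the power `S_1 ^ 0 = 1`
already contains `S_0`, whence the subtracted `|⟨h⟩|²`.

Positivity. The vector `b_1` lies in the kernel of `S_1`, where the Poisson kernel is `1`, so
Cauchy–Schwarz bounds `|⟨h⟩|²` by the sum of kernels. -/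

theorem integerComb_eq_map :
    integerComb = (Measure.count : Measure ℤ).map (fun m : ℤ => (m : ℝ)) := by
  have hm : Measurable (fun m : ℤ => (m : ℝ)) := measurable_of_countable _
  rw [Measure.count, Measure.map_sum hm.aemeasurable, integerComb]
  simp [Measure.map_dirac]

theorem measurableEmbedding_intCast : MeasurableEmbedding (fun m : ℤ => (m : ℝ)) :=
  Int.isClosedEmbedding_coe_real.measurableEmbedding

theorem integrable_integerComb_iff {F : ℝ → ℂ} :
    Integrable F integerComb ↔ Summable fun m : ℤ => F m := by
  rw [integerComb_eq_map, measurableEmbedding_intCast.integrable_map_iff, integrable_count_iff]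
  exact summable_norm_iff

theorem integral_integerComb {F : ℝ → ℂ} (hF : Summable fun m : ℤ => F m) :
    ∫ x, F x ∂integerComb = ∑' m : ℤ, F m := by
  have h := hF
  rw [← integrable_integerComb_iff, integerComb_eq_map,
    measurableEmbedding_intCast.integrable_map_iff] at h
  rw [integerComb_eq_map, measurableEmbedding_intCast.integral_map]
  have h2 := integral_countable h
  simp only [Measure.real, Measure.count_singleton, ENNReal.toReal_one, one_smul,
    Function.comp] at h2
  exact h2

instance hasTemperateGrowth_integerComb : integerComb.HasTemperateGrowth := by
  refine ⟨2, ?_⟩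
  rw [integerComb_eq_map, measurableEmbedding_intCast.integrable_map_iff, integrable_count_iff]
  have h := Real.summable_abs_int_rpow (b := 2) one_lt_two
  -- This extra term covers `m = 0`, where the real power `|0| ^ (-2)` is `0` by convention.
  have h0 : Summable fun m : ℤ => if m = 0 then (1 : ℝ) else 0 :=
    summable_of_ne_finset_zero (s := {0}) (by intro b hb; simpa using hb)
  refine (h.add h0).of_nonneg_of_le (fun m => by simp only [Function.comp]; positivity) fun m => ?_
  rcases eq_or_ne m 0 with rfl | hm
  · simp
  · simp only [Function.comp, hm, if_false, add_zero]
    have hm0 : 0 < |(m : ℝ)| := by simpa using hm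
    rw [Real.norm_of_nonneg (by positivity)]
    exact Real.rpow_le_rpow_of_nonpos hm0 (by rw [Real.norm_eq_abs]; linarith) (by norm_num)

theorem setIntegral_integerComb (F : ℝ → ℂ) (R : ℝ) :
    ∫ x in Metric.closedBall 0 R, F x ∂integerComb = ∑ m ∈ Finset.Icc (-⌊R⌋) ⌊R⌋, F m := by
  have hpre : ∀ m : ℤ, ((m : ℝ) ∈ Metric.closedBall (0 : ℝ) R) ↔ m ∈ Finset.Icc (-⌊R⌋) ⌊R⌋ := by
    intro m
    rw [mem_closedBall_zero_iff, Real.norm_eq_abs, abs_le, Finset.mem_Icc, neg_le,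
      neg_le (a := ⌊R⌋), Int.le_floor, Int.le_floor]
    push_cast
    rfl
  rw [← integral_indicator Metric.isClosed_closedBall.measurableSet]
  have h0 : ∀ m ∉ Finset.Icc (-⌊R⌋) ⌊R⌋,
      (Metric.closedBall (0 : ℝ) R).indicator F (m : ℝ) = 0 := fun m hm =>
    Set.indicator_of_notMem (by rwa [hpre]) _
  rw [integral_integerComb (summable_of_ne_finset_zero h0), tsum_eq_sum h0]
  exact Finset.sum_congr rfl fun m hm => Set.indicator_of_mem (by rwa [hpre]) _

/-! ### Autocorrelation of weighted Dirac combs -/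

namespace CMeasure

theorem approxAutocorrelation_weightedComb (w : ℤ → ℂ) {R : ℝ} (hR : 0 ≤ R) (f : ℝ → ℂ) :
    (weightedComb w).approxAutocorrelation R f = ((2 * R : ℝ) : ℂ)⁻¹ *
      ∑ j ∈ Finset.Icc (-⌊R⌋) ⌊R⌋, ∑ k ∈ Finset.Icc (-⌊R⌋) ⌊R⌋,
        f ((j - k : ℤ) : ℝ) * (w j * conj (w k)) := by
  have hemb : MeasurableEmbedding (fun y : ℝ => -y) :=
    (Homeomorph.neg ℝ).measurableEmbedding
  rw [approxAutocorrelation, Real.volume_closedBall, ENNReal.toReal_ofReal (by linarith)]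
  congr 1
  simp only [convEval, eval, restrictBall, tilde, weightedComb]
  rw [setIntegral_integerComb]
  refine Finset.sum_congr rfl fun j _ => ?_
  rw [hemb.integral_map, setIntegral_integerComb, Finset.sum_mul]
  refine Finset.sum_congr rfl fun k _ => ?_
  simp only [neg_neg, Int.floor_intCast]
  push_cast
  ring_nf

/-- The sum of `w (k + m) * conj (w k)` over all `k` such that both indices are in `[-N, N]`. -/
def correlationSum (w : ℤ → ℂ) (N m : ℤ) : ℂ :=
  ∑ k ∈ Finset.Icc (-N) N with k + m ∈ Finset.Icc (-N) N, w (k + m) * conj (w k)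

/-- The substitution `k ↦ k - m` moves the shift to the conjugated factor. The law of large numbers
is therefore needed for `m ≥ 0` only. -/
theorem correlationSum_neg (w : ℤ → ℂ) (N m : ℤ) :
    correlationSum w N (-m) = conj (correlationSum w N m) := by
  rw [correlationSum, correlationSum, map_sum]
  refine Finset.sum_bij' (fun k _ => k - m) (fun k _ => k + m) ?_ ?_ ?_ ?_ ?_
  · intro k hk; simp only [Finset.mem_filter, Finset.mem_Icc] at hk ⊢; omega
  · intro k hk; simp only [Finset.mem_filter, Finset.mem_Icc] at hk ⊢; omega
  · intro k _; ring
  · intro k _; ring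
  · intro k _
    simp only [map_mul, Complex.conj_conj, sub_add_cancel, ← sub_eq_add_neg]
    ring

theorem correlationSum_natCast (w : ℤ → ℂ) (N : ℤ) (m : ℕ) :
    correlationSum w N m = ∑ k ∈ Finset.Icc (-N) (N - m), w (k + m) * conj (w k) := by
  rw [correlationSum]
  congr 1
  ext k
  simp only [Finset.mem_filter, Finset.mem_Icc]
  omega

/-- Pairs `(j, k)` are grouped by their difference `m = j - k`; only finitely many differences meet
the support of a test function. -/
theorem sum_sum_eq_sum_correlationSum (w : ℤ → ℂ) (N : ℤ) (s : Finset ℤ) (g : ℤ → ℂ)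
    (hg : ∀ m ∉ s, g m = 0) :
    ∑ j ∈ Finset.Icc (-N) N, ∑ k ∈ Finset.Icc (-N) N, g (j - k) * (w j * conj (w k)) =
      ∑ m ∈ s, g m * correlationSum w N m := by
  simp only [correlationSum, Finset.mul_sum]
  have hswap := Finset.sum_comm' (s := s)
    (t := fun m => (Finset.Icc (-N) N).filter fun k => k + m ∈ Finset.Icc (-N) N)
    (t' := Finset.Icc (-N) N) (s' := fun k => s.filter fun m => k + m ∈ Finset.Icc (-N) N)
    (f := fun m k => g m * (w (k + m) * conj (w k)))
    (fun m k => by simp only [Finset.mem_filter]; tauto)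
  rw [Finset.sum_comm, hswap]
  · refine Finset.sum_congr rfl fun k _ => ?_
    rw [← Finset.sum_filter_of_ne (s := Finset.Icc (-N) N) (p := fun j => j - k ∈ s)]
    · refine Finset.sum_bij' (fun j _ => j - k) (fun m _ => k + m) ?_ ?_ ?_ ?_ ?_
      · intro j hj; simp only [Finset.mem_filter] at hj ⊢; simpa using hj.symm
      · intro j hj; simp only [Finset.mem_filter] at hj ⊢; simpa using hj.symm
      · intro j _; ring
      · intro j _; ring
      · intro j _; simp
    · intro j _ hj
      by_contra hs
      simp [hg _ hs] at hj

/-- A weighted comb has a natural autocorrelation if its correlation averages converge. -/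
theorem isNaturalAutocorrelation_weightedComb {w c : ℤ → ℂ}
    (hconj : ∀ m, c (-m) = conj (c m))
    (hlim : ∀ m : ℕ, Tendsto (fun N : ℕ => ((N : ℝ) : ℂ)⁻¹ *
      ∑ k ∈ Finset.Icc (-(N : ℤ)) (N - m), w (k + m) * conj (w k)) atTop (𝓝 (2 * c m))) :
    (weightedComb w).IsNaturalAutocorrelation (weightedComb c) := by
  have hlim' : ∀ m : ℤ, Tendsto (fun N : ℕ => ((N : ℝ) : ℂ)⁻¹ * correlationSum w N m) atTop
      (𝓝 (2 * c m)) := by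
    intro m
    obtain ⟨l, rfl | rfl⟩ := m.eq_nat_or_neg
    · simpa only [correlationSum_natCast] using hlim l
    · have h := (Complex.continuous_conj.tendsto _).comp (hlim l)
      simp only [Function.comp_def, map_mul, map_inv₀, Complex.conj_ofReal,
        ← correlationSum_natCast, ← correlationSum_neg, ← hconj, map_ofNat] at h
      exact h
  -- The sum depends on `R` only through `⌊R⌋`, and `⌊R⌋ / R → 1`; the factor `1 / 2` accounts for
  -- the length `2R` of the ball.
  have hR : ∀ m : ℤ, Tendsto (fun R : ℝ => ((2 * R : ℝ) : ℂ)⁻¹ * correlationSum w ⌊R⌋ m) atTop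
      (𝓝 (c m)) := by
    intro m
    have h1 : Tendsto (fun R : ℝ => (((⌊R⌋₊ : ℝ) / R : ℝ) : ℂ)) atTop (𝓝 1) := by
      have := (Complex.continuous_ofReal.tendsto _).comp (tendsto_nat_floor_div_atTop (R := ℝ))
      simpa [Function.comp_def] using this
    have h2 := (((hlim' m).comp (tendsto_nat_floor_atTop (α := ℝ))).mul h1).mul_const (1 / 2 : ℂ)
    have h3 : 2 * c m * 1 * (1 / 2) = c m := by ring
    rw [h3] at h2
    refine h2.congr' ?_
    filter_upwards [eventually_ge_atTop (1 : ℝ)] with R hR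
    have hfl : ((⌊R⌋₊ : ℕ) : ℤ) = ⌊R⌋ := Int.natCast_floor_eq_floor (by linarith)
    have hpos : (0 : ℝ) < ⌊R⌋₊ := by exact_mod_cast Nat.floor_pos.2 hR
    have hne : ((⌊R⌋₊ : ℝ) : ℂ) ≠ 0 := by exact_mod_cast hpos.ne'
    have hRne : (R : ℂ) ≠ 0 := by exact_mod_cast (by linarith : R ≠ 0)
    simp only [Function.comp, hfl]
    push_cast at hne ⊢
    field_simp
  intro f
  obtain ⟨r, hr⟩ := f.hasCompactSupport.isCompact.isBounded.subset_closedBall (0 : ℝ)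
  set s : Finset ℤ := Finset.Icc (-⌊r⌋) ⌊r⌋ with hs
  have hf0 : ∀ m ∉ s, f (m : ℝ) = 0 := by
    intro m hm
    by_contra hne
    have hmem := hr (subset_tsupport _ hne)
    rw [mem_closedBall_zero_iff, Real.norm_eq_abs, abs_le] at hmem
    refine hm (Finset.mem_Icc.2 ⟨?_, Int.le_floor.2 hmem.2⟩)
    have : -m ≤ ⌊r⌋ := Int.le_floor.2 (by push_cast; linarith)
    omega
  have heval : (weightedComb c).eval f = ∑ m ∈ s, f (m : ℝ) * c m := by
    have h0 : ∀ m ∉ s, f (m : ℝ) * c ⌊(m : ℝ)⌋ = 0 := fun m hm => by simp [hf0 m hm]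
    change ∫ x, f x * c ⌊x⌋ ∂integerComb = _
    rw [integral_integerComb (F := fun x => f x * c ⌊x⌋) (summable_of_ne_finset_zero h0),
      tsum_eq_sum h0]
    simp
  rw [heval]
  refine (tendsto_finsetSum s fun m _ => (hR m).const_mul (f (m : ℝ))).congr' ?_
  filter_upwards [eventually_ge_atTop (0 : ℝ)] with R hR0
  rw [approxAutocorrelation_weightedComb w hR0,
    sum_sum_eq_sum_correlationSum w ⌊R⌋ s (fun m => f (m : ℝ)) hf0, Finset.mul_sum]
  exact Finset.sum_congr rfl fun m _ => by ring

end CMeasure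

/-! ### Reversible primitive stochastic matrices -/

section Matrices

variable {n : ℕ} {M : Matrix (Fin n) (Fin n) ℝ} {p : Fin n → ℝ}

theorem vecMul_pow_of_stationary (hp : p ᵥ* M = p) (s : ℕ) : p ᵥ* (M ^ s) = p := by
  induction s with
  | zero => simp
  | succ s ih => rw [pow_succ, ← vecMul_vecMul, ih, hp]

/-- Since `p = p M ^ k` with `M ^ k` positive, one vanishing entry of `p` would force all of them to
vanish. -/
theorem pos_of_stationary (hM : M.IsPrimitive) (hp_prob : p ∈ stdSimplex ℝ (Fin n))
    (hp : p ᵥ* M = p) (j : Fin n) : 0 < p j := by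
  obtain ⟨k, -, hk⟩ := hM.exists_pos_pow
  have h : ∑ i, p i * (M ^ k) i j = p j := congrFun (vecMul_pow_of_stationary hp k) j
  have h0 : 0 ≤ p j := hp_prob.1 j
  refine h0.lt_of_ne fun h1 => ?_
  rw [← h1, Finset.sum_eq_zero_iff_of_nonneg
    fun i _ => mul_nonneg (hp_prob.1 i) (hk i j).le] at h
  have hz : ∀ i, p i = 0 := fun i => by simpa [(hk i j).ne'] using h i (Finset.mem_univ i)
  simpa [hz] using hp_prob.2

theorem symMatrix_apply (hpos : ∀ i, 0 < p i) (i j : Fin n) :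
    symMatrix M p i j = √(p i) * M i j * (√(p j))⁻¹ := by
  have hinv : (sqrtDiag p)⁻¹ = diagonal fun i => (√(p i))⁻¹ := by
    refine inv_eq_right_inv ?_
    rw [sqrtDiag, diagonal_mul_diagonal, ← diagonal_one]
    congr 1
    funext i
    exact mul_inv_cancel₀ (Real.sqrt_pos.2 (hpos i)).ne'
  rw [symMatrix, hinv, mul_diagonal, sqrtDiag, diagonal_mul]

theorem contraction_apply (hpos : ∀ i, 0 < p i) (i j : Fin n) :
    contraction M p i j = √(p i) * M i j * (√(p j))⁻¹ - √(p i) * √(p j) := by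
  rw [contraction, Matrix.sub_apply, symMatrix_apply hpos, vecMulVec_apply]
  rfl

theorem contraction_isSymm (hpos : ∀ i, 0 < p i)
    (hrev : Matrix.diagonal p * M = Mᵀ * Matrix.diagonal p) : (contraction M p).IsSymm := by
  ext i j
  have h : p i * M i j = M j i * p j := by
    have := congrFun (congrFun hrev i) j
    rwa [diagonal_mul, mul_diagonal, transpose_apply] at this
  rw [transpose_apply, contraction_apply hpos, contraction_apply hpos]
  have hi := Real.sqrt_pos.2 (hpos i)
  have hj := Real.sqrt_pos.2 (hpos j)
  have hi2 := Real.sq_sqrt (hpos i).le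
  have hj2 := Real.sq_sqrt (hpos j).le
  rw [← hi2, ← hj2] at h
  field_simp
  linarith

/-- The matrix `M - 𝟙 pᵗ`, similar to the contraction `S_1`. -/
def deviation (M : Matrix (Fin n) (Fin n) ℝ) (p : Fin n → ℝ) : Matrix (Fin n) (Fin n) ℝ :=
  M - vecMulVec 1 p

/-- This intertwining carries powers and eigenvectors between `S_1` and `M - 𝟙 pᵗ`. -/
theorem contraction_mul_sqrtDiag (hpos : ∀ i, 0 < p i) :
    contraction M p * sqrtDiag p = sqrtDiag p * deviation M p := by
  ext i j
  have hj := Real.sqrt_pos.2 (hpos j)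
  rw [sqrtDiag, mul_diagonal, diagonal_mul, contraction_apply hpos, deviation, Matrix.sub_apply,
    vecMulVec_apply, Pi.one_apply, one_mul, mul_sub]
  conv_rhs => rw [← Real.mul_self_sqrt (hpos j).le]
  field_simp

/-- By `M 𝟙 = 𝟙` and `p M = p`, the projector `𝟙 pᵗ` absorbs `M` on both sides. The exponent must be
positive: at `0` the left side is the identity. -/
theorem deviation_pow (hM : M ∈ Matrix.rowStochastic ℝ (Fin n))
    (hp_prob : p ∈ stdSimplex ℝ (Fin n)) (hp : p ᵥ* M = p) (s : ℕ) :
    deviation M p ^ (s + 1) = M ^ (s + 1) - vecMulVec 1 p := by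
  have h1 : M *ᵥ 1 = 1 := (mem_rowStochastic.1 hM).2
  have h2 : p ⬝ᵥ 1 = 1 := by simpa [dotProduct] using hp_prob.2
  induction s with
  | zero => simp [deviation]
  | succ s ih =>
    rw [pow_succ', ih, deviation, sub_mul, mul_sub, mul_sub, ← pow_succ', mul_vecMulVec, h1,
      vecMulVec_mul, vecMul_pow_of_stationary hp, vecMulVec_mul_vecMulVec, h2, one_smul]
    abel

theorem contraction_pow_apply (hM : M ∈ Matrix.rowStochastic ℝ (Fin n)) (hpos : ∀ i, 0 < p i)
    (hp_prob : p ∈ stdSimplex ℝ (Fin n)) (hp : p ᵥ* M = p) (s : ℕ) (i j : Fin n) :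
    (contraction M p ^ (s + 1)) i j * √(p j) = √(p i) * ((M ^ (s + 1)) i j - p j) := by
  have h : ∀ t : ℕ, contraction M p ^ t * sqrtDiag p = sqrtDiag p * deviation M p ^ t := by
    intro t
    induction t with
    | zero => simp
    | succ t ih =>
      rw [pow_succ, Matrix.mul_assoc, contraction_mul_sqrtDiag hpos, ← Matrix.mul_assoc, ih,
        Matrix.mul_assoc, ← pow_succ]
  have := congrFun (congrFun (h (s + 1)) i) j
  rw [deviation_pow hM hp_prob hp, sqrtDiag, mul_diagonal, diagonal_mul, Matrix.sub_apply,
    vecMulVec_apply, Pi.one_apply, one_mul] at this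
  exact this

/-- Row sums `1` make `b_1` fixed by `S`, and `S_0` also fixes it. The positivity of the diffuse
density rests on this. -/
theorem contraction_mulVec_leadingVector (hM : M ∈ Matrix.rowStochastic ℝ (Fin n))
    (hpos : ∀ i, 0 < p i) (hp_prob : p ∈ stdSimplex ℝ (Fin n)) :
    contraction M p *ᵥ leadingVector p = 0 := by
  funext i
  have h1 : ∑ j, M i j = 1 := (mem_rowStochastic_iff_sum.1 hM).2 i
  have h2 : ∑ j, p j = 1 := hp_prob.2
  have h : ∀ j, contraction M p i j * leadingVector p j = √(p i) * M i j - √(p i) * p j := by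
    intro j
    have hj := Real.sqrt_pos.2 (hpos j)
    rw [contraction_apply hpos, leadingVector]
    conv_rhs => rw [← Real.mul_self_sqrt (hpos j).le]
    field_simp
  simp only [mulVec, dotProduct, h, Finset.sum_sub_distrib, ← Finset.mul_sum, h1, h2, sub_self,
    Pi.zero_apply]

/-- An eigenvector of a primitive stochastic matrix for an eigenvalue of modulus at least one is
constant. -/
theorem eq_const_of_mulVec_eq_smul (hM : M ∈ Matrix.rowStochastic ℝ (Fin n))
    (hprim : M.IsPrimitive) {q : Fin n → ℝ} {l : ℝ} (hq : M *ᵥ q = l • q) (hl : 1 ≤ |l|) :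
    ∃ c : ℝ, ∀ j, q j = c := by
  rcases isEmpty_or_nonempty (Fin n) with _ | _
  · exact ⟨0, fun j => isEmptyElim j⟩
  obtain ⟨k, -, hk⟩ := hprim.exists_pos_pow
  have hrow : ∀ i, ∑ j, (M ^ k) i j = 1 := (mem_rowStochastic_iff_sum.1 (pow_mem hM k)).2
  have hpow : ∀ s : ℕ, M ^ s *ᵥ q = l ^ s • q := by
    intro s
    induction s with
    | zero => simp
    | succ s ih => rw [pow_succ, ← mulVec_mulVec, hq, mulVec_smul, ih, smul_smul, pow_succ']
  obtain ⟨i, hi⟩ := Finite.exists_max fun j => |q j|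
  have heq : ∑ j, (M ^ k) i j * q j = l ^ k * q i := congrFun (hpow k) i
  -- Row `i` of `M ^ k` averages `q` with strictly positive weights, yet the average has modulus at
  -- least the maximum `|q i|`. Equality then forces every `q j` to be the same extremal value, of
  -- sign `σ`.
  have hge : |q i| ≤ |∑ j, (M ^ k) i j * q j| := by
    rw [heq, abs_mul, abs_pow]
    exact le_mul_of_one_le_left (abs_nonneg _) (one_le_pow₀ hl)
  obtain ⟨σ, hσ, hσ'⟩ : ∃ σ : ℝ, |σ| = 1 ∧
      |∑ j, (M ^ k) i j * q j| = σ * ∑ j, (M ^ k) i j * q j := by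
    rcases abs_choice (∑ j, (M ^ k) i j * q j) with h | h
    · exact ⟨1, by simp, by rw [h, one_mul]⟩
    · exact ⟨-1, by simp, by rw [h, neg_one_mul]⟩
  have hle : ∀ j, σ * q j ≤ |q i| := fun j => by
    refine (le_abs_self _).trans ?_
    rw [abs_mul, hσ, one_mul]
    exact hi j
  have hnn : ∀ j ∈ Finset.univ, 0 ≤ (M ^ k) i j * (|q i| - σ * q j) := fun j _ =>
    mul_nonneg (hk i j).le (sub_nonneg.2 (hle j))
  have hsum : ∑ j, (M ^ k) i j * (|q i| - σ * q j) = 0 := by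
    refine le_antisymm ?_ (Finset.sum_nonneg hnn)
    have : ∑ j, (M ^ k) i j * (|q i| - σ * q j) =
        (∑ j, (M ^ k) i j) * |q i| - σ * ∑ j, (M ^ k) i j * q j := by
      rw [Finset.sum_mul, Finset.mul_sum, ← Finset.sum_sub_distrib]
      exact Finset.sum_congr rfl fun j _ => by ring
    rw [this, hrow, one_mul, ← hσ']
    linarith
  have hσ2 : σ * σ = 1 := by rw [← abs_mul_abs_self, hσ, one_mul]
  refine ⟨σ * |q i|, fun j => ?_⟩
  have h := (Finset.sum_eq_zero_iff_of_nonneg hnn).1 hsum j (Finset.mem_univ j)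
  have h' : |q i| = σ * q j := by
    have := (mul_eq_zero.1 h).resolve_left (hk i j).ne'
    linarith
  rw [h', ← mul_assoc, hσ2, one_mul]

theorem abs_lt_one_of_contraction_mulVec_eq_smul (hM : M ∈ Matrix.rowStochastic ℝ (Fin n))
    (hprim : M.IsPrimitive) (hp_prob : p ∈ stdSimplex ℝ (Fin n)) (hp : p ᵥ* M = p)
    {w : Fin n → ℝ} {l : ℝ} (hw : contraction M p *ᵥ w = l • w) (hw0 : w ≠ 0) : |l| < 1 := by
  have hpos := pos_of_stationary hprim hp_prob hp
  by_contra! hl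
  have hsq : ∀ i, √(p i) ≠ 0 := fun i => (Real.sqrt_pos.2 (hpos i)).ne'
  set q : Fin n → ℝ := fun i => w i / √(p i) with hq
  have hPq : w = sqrtDiag p *ᵥ q := by
    funext i
    rw [sqrtDiag, mulVec_diagonal, hq, mul_div_cancel₀ _ (hsq i)]
  have hdev : deviation M p *ᵥ q = l • q := by
    rw [hPq, mulVec_mulVec, contraction_mul_sqrtDiag hpos, ← mulVec_mulVec, ← mulVec_smul] at hw
    funext i
    have := congrFun hw i
    rw [sqrtDiag, mulVec_diagonal, mulVec_diagonal] at this
    exact mul_left_cancel₀ (hsq i) this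
  have hdev' : M *ᵥ q - (p ⬝ᵥ q) • 1 = l • q := by
    rw [← hdev, deviation, sub_mulVec, vecMulVec_mulVec]
    simp
  have h1 : p ⬝ᵥ (1 : Fin n → ℝ) = 1 := by simpa [dotProduct] using hp_prob.2
  -- Pairing with `p` cancels the left side, as `p M = p` and `p ⬝ᵥ 1 = 1`; since `l ≠ 0`, `q` is
  -- orthogonal to `p`. The projector term drops out, so `q` is an eigenvector of `M` itself.
  have hpq : p ⬝ᵥ q = 0 := by
    have h := congrArg (fun v => p ⬝ᵥ v) hdev'
    simp only [dotProduct_sub, dotProduct_mulVec, hp, dotProduct_smul, h1, smul_eq_mul] at h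
    have h' : l * (p ⬝ᵥ q) = 0 := by linarith
    refine (mul_eq_zero.1 h').resolve_left ?_
    rintro rfl
    simp at hl
    linarith
  rw [hpq, zero_smul, sub_zero] at hdev'
  obtain ⟨c, hc⟩ := eq_const_of_mulVec_eq_smul hM hprim hdev' hl
  have hc0 : c = 0 := by
    have : q = c • (1 : Fin n → ℝ) := by funext j; simp [hc j]
    rw [this, dotProduct_smul, h1] at hpq
    simpa using hpq
  refine hw0 ?_
  rw [hPq]
  have : q = 0 := by funext j; simp [hc j, hc0]
  rw [this, mulVec_zero]

/-- The contraction `S_1` is orthogonally diagonalisable with eigenvalues in `(-1, 1)`. -/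
theorem exists_contraction_eq (hM : M ∈ Matrix.rowStochastic ℝ (Fin n))
    (hprim : M.IsPrimitive) (hp_prob : p ∈ stdSimplex ℝ (Fin n)) (hp : p ᵥ* M = p)
    (hrev : Matrix.diagonal p * M = Mᵀ * Matrix.diagonal p) :
    ∃ (U : Matrix (Fin n) (Fin n) ℝ) (l : Fin n → ℝ), U * Uᵀ = 1 ∧ Uᵀ * U = 1 ∧
      contraction M p = U * diagonal l * Uᵀ ∧ ∀ i, |l i| < 1 := by
  have hpos := pos_of_stationary hprim hp_prob hp
  have hH : (contraction M p).IsHermitian := by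
    rw [Matrix.IsHermitian, conjTranspose_eq_transpose_of_trivial]
    exact contraction_isSymm hpos hrev
  set U : Matrix (Fin n) (Fin n) ℝ := (hH.eigenvectorUnitary).1 with hU
  have hstar : star U = Uᵀ := by
    rw [star_eq_conjTranspose, conjTranspose_eq_transpose_of_trivial]
  have h1 : U * Uᵀ = 1 := by rw [← hstar]; exact Unitary.coe_mul_star_self _
  have h2 : Uᵀ * U = 1 := by rw [← hstar]; exact Unitary.coe_star_mul_self _
  have h3 : contraction M p = U * diagonal hH.eigenvalues * Uᵀ := by
    conv_lhs => rw [hH.spectral_theorem]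
    rw [Unitary.conjStarAlgAut_apply, ← hstar]
    rfl
  generalize hH.eigenvalues = l at h3
  refine ⟨U, l, h1, h2, h3, fun i => ?_⟩
  -- Column `i` of `U` is an eigenvector for `l i`.
  have hcol : contraction M p *ᵥ (U *ᵥ Pi.single i 1) =
      l i • (U *ᵥ Pi.single i 1) := by
    rw [mulVec_mulVec, h3, Matrix.mul_assoc, h2, Matrix.mul_one, ← mulVec_mulVec, ← mulVec_smul]
    congr 1
    funext j
    rw [mulVec_diagonal, Pi.smul_apply, smul_eq_mul]
    rcases eq_or_ne j i with rfl | hj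
    · rfl
    · simp [hj]
  refine abs_lt_one_of_contraction_mulVec_eq_smul hM hprim hp_prob hp hcol fun h0 => ?_
  have : Uᵀ *ᵥ (U *ᵥ Pi.single i 1) = 0 := by rw [h0, mulVec_zero]
  rw [mulVec_mulVec, h2, one_mulVec] at this
  simpa using congrFun this i

/-! ### Functional calculus in an orthonormal eigenbasis -/

theorem conj_diagonal_mul {U : Matrix (Fin n) (Fin n) ℝ} (hU : Uᵀ * U = 1) (a b : Fin n → ℝ) :
    U * diagonal a * Uᵀ * (U * diagonal b * Uᵀ) = U * diagonal (a * b) * Uᵀ := by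
  calc _ = U * diagonal a * (Uᵀ * U) * diagonal b * Uᵀ := by simp only [Matrix.mul_assoc]
    _ = U * (diagonal a * diagonal b) * Uᵀ := by rw [hU, Matrix.mul_one, Matrix.mul_assoc U]
    _ = _ := by rw [diagonal_mul_diagonal]; rfl

theorem conj_diagonal_pow {U : Matrix (Fin n) (Fin n) ℝ} (hU : U * Uᵀ = 1) (hU' : Uᵀ * U = 1)
    (a : Fin n → ℝ) (s : ℕ) :
    (U * diagonal a * Uᵀ) ^ s = U * diagonal (a ^ s) * Uᵀ := by
  induction s with
  | zero =>
    have : diagonal ((1 : Fin n → ℝ)) = 1 := diagonal_one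
    rw [pow_zero, pow_zero, this, Matrix.mul_one, hU]
  | succ s ih => rw [pow_succ, ih, conj_diagonal_mul hU', pow_succ]

/-- The powers of a reversible primitive stochastic matrix converge geometrically. -/
theorem exists_abs_pow_sub_le (hM : M ∈ Matrix.rowStochastic ℝ (Fin n))
    (hprim : M.IsPrimitive) (hp_prob : p ∈ stdSimplex ℝ (Fin n)) (hp : p ᵥ* M = p)
    (hrev : Matrix.diagonal p * M = Mᵀ * Matrix.diagonal p) :
    ∃ C r : ℝ, 0 ≤ C ∧ 0 < r ∧ r < 1 ∧
      ∀ (s : ℕ) (i j : Fin n), |(M ^ s) i j - p j| ≤ C * r ^ s := by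
  have hpos := pos_of_stationary hprim hp_prob hp
  obtain ⟨U, l, hU, hU', hA, hl⟩ := exists_contraction_eq hM hprim hp_prob hp hrev
  obtain ⟨r, hr0, hr1, hr⟩ : ∃ r : ℝ, 0 < r ∧ r < 1 ∧ ∀ i, |l i| ≤ r := by
    rcases isEmpty_or_nonempty (Fin n) with _ | _
    · exact ⟨1 / 2, by norm_num, by norm_num, fun i => isEmptyElim i⟩
    · obtain ⟨i, hi⟩ := Finite.exists_max fun j => |l j|
      -- The `1 / 2` keeps `r` positive even if `S_1 = 0`; powers of `r` are divided by later.
      exact ⟨max (1 / 2) |l i|, by positivity, max_lt (by norm_num) (hl i),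
        fun j => (hi j).trans (le_max_right _ _)⟩
  have hent : ∀ (s : ℕ) i j, |(contraction M p ^ s) i j| ≤ (∑ k, |U i k| * |U j k|) * r ^ s := by
    intro s i j
    rw [hA, conj_diagonal_pow hU hU', mul_apply, Finset.sum_mul]
    refine (Finset.abs_sum_le_sum_abs _ _).trans (Finset.sum_le_sum fun k _ => ?_)
    rw [mul_diagonal, transpose_apply, abs_mul, abs_mul, Pi.pow_apply, abs_pow,
      mul_right_comm]
    have := pow_le_pow_left₀ (abs_nonneg _) (hr k) s
    gcongr
  set D : Fin n → Fin n → ℝ := fun i j => (√(p i))⁻¹ * (∑ k, |U i k| * |U j k|) * √(p j)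
    with hD
  have hD0 : ∀ i j, 0 ≤ D i j := fun i j => by positivity
  -- The summand `1` serves `s = 0`, where the formula through powers of `S_1` is not available.
  refine ⟨1 + ∑ i, ∑ j, D i j, r,
    add_nonneg zero_le_one (Finset.sum_nonneg fun i _ => Finset.sum_nonneg fun j _ => hD0 i j),
    hr0, hr1, ?_⟩
  have hDle : ∀ i j, D i j ≤ ∑ i, ∑ j, D i j := fun i j =>
    (Finset.single_le_sum (f := fun j => D i j) (fun j _ => hD0 i j) (Finset.mem_univ j)).trans
      (Finset.single_le_sum (f := fun i => ∑ j, D i j)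
        (fun i _ => Finset.sum_nonneg fun j _ => hD0 i j) (Finset.mem_univ i))
  rintro (_ | s) i j
  · have h1 : p j ≤ 1 := by
      rw [← hp_prob.2]
      exact Finset.single_le_sum (fun i _ => hp_prob.1 i) (Finset.mem_univ j)
    have h2 := hpos j
    have h3 := (hD0 i j).trans (hDle i j)
    rw [pow_zero, pow_zero, mul_one, abs_le, one_apply]
    split_ifs <;> constructor <;> linarith
  · have h := contraction_pow_apply hM hpos hp_prob hp s i j
    have hi := Real.sqrt_pos.2 (hpos i)
    have h' : (M ^ (s + 1)) i j - p j =
        (√(p i))⁻¹ * (contraction M p ^ (s + 1)) i j * √(p j) := by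
      rw [mul_assoc, h, inv_mul_cancel_left₀ hi.ne']
    rw [h', abs_mul, abs_mul, abs_of_pos (inv_pos.2 hi), abs_of_nonneg (Real.sqrt_nonneg (p j))]
    calc _ ≤ (√(p i))⁻¹ * ((∑ k, |U i k| * |U j k|) * r ^ (s + 1)) * √(p j) := by
          gcongr; exact hent _ _ _
      _ = D i j * r ^ (s + 1) := by rw [hD]; ring
      _ ≤ _ := by
          gcongr
          exact (hDle i j).trans (by linarith)

/-- The Poisson kernel `(1 - l²) / (1 - 2 l cos(2πk) + l²)`. -/
def radialPoissonKernel (l k : ℝ) : ℝ :=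
  (1 - l ^ 2) / (1 - 2 * Real.cos (2 * Real.pi * k) * l + l ^ 2)

/-- As `|cos| ≤ 1`, the denominator is at least `(1 - |l|)²`. -/
theorem radialPoissonKernel_denominator_pos {l : ℝ} (hl : |l| < 1) (k : ℝ) :
    0 < 1 - 2 * Real.cos (2 * Real.pi * k) * l + l ^ 2 := by
  obtain ⟨h1, h2⟩ := abs_lt.1 hl
  have hc1 := Real.cos_le_one (2 * Real.pi * k)
  have hc2 := Real.neg_one_le_cos (2 * Real.pi * k)
  rcases le_total 0 l with h | h
  · nlinarith [mul_le_mul_of_nonneg_right hc1 h, sq_pos_of_pos (sub_pos.2 h2)]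
  · nlinarith [mul_le_mul_of_nonpos_right hc2 h, sq_pos_of_pos (by linarith : 0 < 1 + l)]

theorem radialPoissonKernel_nonneg {l : ℝ} (hl : |l| < 1) (k : ℝ) : 0 ≤ radialPoissonKernel l k :=
  div_nonneg (sub_nonneg.2 ((sq_lt_one_iff_abs_lt_one l).2 hl).le)
    (radialPoissonKernel_denominator_pos hl k).le

theorem continuous_radialPoissonKernel {l : ℝ} (hl : |l| < 1) :
    Continuous (radialPoissonKernel l) :=
  Continuous.div (by fun_prop) (by fun_prop) fun k => (radialPoissonKernel_denominator_pos hl k).ne'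

theorem periodic_radialPoissonKernel (l : ℝ) :
    Function.Periodic (radialPoissonKernel l) 1 := fun k => by
  rw [radialPoissonKernel, radialPoissonKernel, mul_add, mul_one, Real.cos_add_two_pi]

/-- The quadratic form becomes diagonal in the coordinates `Uᵀ P h` of `P h`. -/
theorem braket_sqrtDiag_conj_diagonal (h : Fin n → ℂ) (U : Matrix (Fin n) (Fin n) ℝ)
    (g : Fin n → ℝ) :
    braket h (sqrtDiag p * (U * diagonal g * Uᵀ) * sqrtDiag p) =
      ((∑ k, g k * ‖∑ i, (U i k : ℂ) * √(p i) * h i‖ ^ 2 : ℝ) : ℂ) := by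
  have hent : ∀ i j, (sqrtDiag p * (U * diagonal g * Uᵀ) * sqrtDiag p) i j =
      ∑ k, √(p i) * (U i k * g k * U j k) * √(p j) := by
    intro i j
    rw [sqrtDiag, mul_diagonal, diagonal_mul, mul_apply, Finset.mul_sum, Finset.sum_mul]
    simp only [mul_diagonal, transpose_apply]
  have hsq : ∀ k, (‖∑ i, (U i k : ℂ) * √(p i) * h i‖ : ℂ) ^ 2 =
      ∑ i, ∑ j, (U i k * √(p i) * conj (h i)) * (U j k * √(p j) * h j) := by
    intro k
    rw [← Complex.conj_mul', map_sum, Finset.sum_mul_sum]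
    simp only [map_mul, Complex.conj_ofReal]
  rw [braket]
  push_cast
  simp only [hent, hsq, Finset.mul_sum]
  rw [Finset.sum_comm]
  conv_rhs => rw [Finset.sum_comm]
  rw [Finset.sum_comm]
  refine Finset.sum_congr rfl fun i _ => ?_
  conv_rhs => rw [Finset.sum_comm]
  refine Finset.sum_congr rfl fun j _ => ?_
  push_cast
  rw [Finset.mul_sum, Finset.sum_mul]
  exact Finset.sum_congr rfl fun k _ => by ring

theorem conj_diagonal_add (U : Matrix (Fin n) (Fin n) ℝ) (a b : Fin n → ℝ) :
    U * diagonal a * Uᵀ + U * diagonal b * Uᵀ = U * diagonal (a + b) * Uᵀ := by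
  rw [← Matrix.add_mul, ← Matrix.mul_add, diagonal_add]
  rfl

theorem conj_diagonal_sub (U : Matrix (Fin n) (Fin n) ℝ) (a b : Fin n → ℝ) :
    U * diagonal a * Uᵀ - U * diagonal b * Uᵀ = U * diagonal (a - b) * Uᵀ := by
  rw [← Matrix.sub_mul, ← Matrix.mul_sub, diagonal_sub]
  rfl

theorem conj_diagonal_smul (U : Matrix (Fin n) (Fin n) ℝ) (c : ℝ) (a : Fin n → ℝ) :
    c • (U * diagonal a * Uᵀ) = U * diagonal (c • a) * Uᵀ := by
  rw [diagonal_smul, Matrix.mul_smul, Matrix.smul_mul]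

/-- The spectral data of the contraction `S_1` that govern the autocorrelation and the
diffraction. -/
theorem exists_spectral_representation (hM : M ∈ Matrix.rowStochastic ℝ (Fin n))
    (hprim : M.IsPrimitive) (hp_prob : p ∈ stdSimplex ℝ (Fin n)) (hp : p ᵥ* M = p)
    (hrev : Matrix.diagonal p * M = Mᵀ * Matrix.diagonal p) (h : Fin n → ℂ) :
    ∃ (l β : Fin n → ℝ) (v : Fin n → ℂ), (∀ i, |l i| < 1) ∧ (∀ i, l i * β i = 0) ∧
      ∑ i, β i ^ 2 = 1 ∧ ∑ i, (β i : ℂ) * v i = mean p h ∧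
      (∀ k, IsUnit (denominator M p k)) ∧
      (∀ k, diffuseFormula M p h k =
        ((∑ i, radialPoissonKernel (l i) k * ‖v i‖ ^ 2 - ‖mean p h‖ ^ 2 : ℝ) : ℂ)) ∧
      ∀ s : ℕ, braket h (sqrtDiag p * contraction M p ^ s * sqrtDiag p) =
        ((∑ i, l i ^ s * ‖v i‖ ^ 2 : ℝ) : ℂ) := by
  have hpos := pos_of_stationary hprim hp_prob hp
  obtain ⟨U, l, hU, hU', hA, hl⟩ := exists_contraction_eq hM hprim hp_prob hp hrev
  have hone : (1 : Matrix (Fin n) (Fin n) ℝ) = U * diagonal 1 * Uᵀ := by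
    have : diagonal ((1 : Fin n → ℝ)) = 1 := diagonal_one
    rw [this, Matrix.mul_one, hU]
  have hD : ∀ k, denominator M p k =
      U * diagonal (1 - (2 * Real.cos (2 * Real.pi * k)) • l + l ^ 2) * Uᵀ := by
    intro k
    rw [denominator, hA, conj_diagonal_pow hU hU', conj_diagonal_smul]
    nth_rw 1 [hone]
    rw [conj_diagonal_sub, conj_diagonal_add]
  set E : ℝ → Fin n → ℝ := fun k i =>
    (1 - 2 * Real.cos (2 * Real.pi * k) * l i + l i ^ 2)⁻¹ with hE
  have hDE : ∀ k, denominator M p k * (U * diagonal (E k) * Uᵀ) = 1 := by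
    intro k
    rw [hD, conj_diagonal_mul hU', hone]
    congr 3
    funext i
    exact mul_inv_cancel₀ (radialPoissonKernel_denominator_pos (hl i) k).ne'
  have hvec : ∀ a : Fin n → ℝ, (U * diagonal a * Uᵀ) *ᵥ leadingVector p =
      U *ᵥ fun i => a i * (Uᵀ *ᵥ leadingVector p) i := by
    intro a
    rw [← mulVec_mulVec, ← mulVec_mulVec]
    congr 1
    funext i
    rw [mulVec_diagonal]
  have hnorm : leadingVector p ⬝ᵥ leadingVector p = 1 := by
    rw [← hp_prob.2]
    exact Finset.sum_congr rfl fun i _ => Real.mul_self_sqrt (hpos i).le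
  -- Here `β` and `v` are the coordinates of `b_1` and of `P h` in the eigenbasis. Then `l i * β i =
  -- 0` says `S_1 b_1 = 0`, `∑ β² = 1` is Parseval, and `∑ β v = ⟨b_1, P h⟩ = ⟨h⟩`.
  refine ⟨l, Uᵀ *ᵥ leadingVector p, fun k => ∑ i, (U i k : ℂ) * √(p i) * h i, hl, fun i => ?_, ?_,
    ?_, fun k => ?_, fun k => ?_, fun s => ?_⟩
  · have h0 := contraction_mulVec_leadingVector hM hpos hp_prob
    rw [hA, hvec] at h0
    have := congrArg (fun v => Uᵀ *ᵥ v) h0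
    rw [mulVec_zero, mulVec_mulVec, hU', one_mulVec] at this
    exact congrFun this i
  · have : ∑ i, (Uᵀ *ᵥ leadingVector p) i ^ 2 =
        (Uᵀ *ᵥ leadingVector p) ⬝ᵥ (Uᵀ *ᵥ leadingVector p) :=
      Finset.sum_congr rfl fun i _ => sq _
    rw [this, dotProduct_mulVec, vecMul_transpose, mulVec_mulVec, hU, one_mulVec, hnorm]
  · have hcomp : ∀ i, ∑ k, (U i k : ℂ) * ((Uᵀ *ᵥ leadingVector p) k : ℂ) = √(p i) := by
      intro i
      have : (U *ᵥ (Uᵀ *ᵥ leadingVector p)) i = √(p i) := by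
        rw [mulVec_mulVec, hU, one_mulVec]; rfl
      rw [← this]
      simp [mulVec, dotProduct]
    simp only [Finset.mul_sum]
    rw [Finset.sum_comm, mean]
    refine Finset.sum_congr rfl fun i _ => ?_
    calc _ = (∑ k, (U i k : ℂ) * ((Uᵀ *ᵥ leadingVector p) k : ℂ)) * (√(p i) * h i) := by
          rw [Finset.sum_mul]
          exact Finset.sum_congr rfl fun k _ => by ring
      _ = _ := by
          rw [hcomp, ← mul_assoc, ← Complex.ofReal_mul, Real.mul_self_sqrt (hpos i).le]
  · exact IsUnit.of_mul_eq_one _ (hDE k)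
  · rw [diffuseFormula, inv_eq_right_inv (hDE k), hA, conj_diagonal_pow hU hU']
    nth_rw 1 [hone]
    rw [conj_diagonal_sub, conj_diagonal_mul hU', braket_sqrtDiag_conj_diagonal, Complex.ofReal_sub]
    rfl
  · rw [hA, conj_diagonal_pow hU hU', braket_sqrtDiag_conj_diagonal]
    rfl

/-- The two-point correlations of the stationary process in terms of `S_1`. -/
theorem sum_conj_mul_pow_mulVec (hM : M ∈ Matrix.rowStochastic ℝ (Fin n)) (hpos : ∀ i, 0 < p i)
    (hp_prob : p ∈ stdSimplex ℝ (Fin n)) (hp : p ᵥ* M = p) (h : Fin n → ℂ) (s : ℕ) :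
    ∑ i, (p i : ℂ) * (conj (h i) * ∑ j, ((M ^ s) i j : ℂ) * h j) =
      braket h (sqrtDiag p * contraction M p ^ s * sqrtDiag p) +
        if s = 0 then 0 else ((‖mean p h‖ ^ 2 : ℝ) : ℂ) := by
  have hb : ∀ i j, (sqrtDiag p * contraction M p ^ s * sqrtDiag p) i j =
      p i * ((M ^ s) i j - if s = 0 then 0 else p j) := by
    intro i j
    rw [sqrtDiag, mul_diagonal, diagonal_mul, mul_assoc]
    rcases s with _ | s
    · rw [pow_zero, pow_zero, one_apply]
      rcases eq_or_ne i j with rfl | hij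
      · simp [Real.mul_self_sqrt (hpos i).le]
      · simp [hij]
    · have := contraction_pow_apply hM hpos hp_prob hp s i j
      rw [this, ← mul_assoc, Real.mul_self_sqrt (hpos i).le]
      simp
  have hm : ((‖mean p h‖ ^ 2 : ℝ) : ℂ) = ∑ i, ∑ j, conj (h i) * (p i * p j : ℝ) * h j := by
    push_cast
    rw [← Complex.conj_mul', mean, map_sum, Finset.sum_mul_sum]
    refine Finset.sum_congr rfl fun i _ => Finset.sum_congr rfl fun j _ => ?_
    rw [map_mul, Complex.conj_ofReal]
    ring
  rw [braket]
  simp only [hb]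
  rcases s with _ | s
  · simp only [if_true, add_zero, sub_zero, Finset.mul_sum]
    refine Finset.sum_congr rfl fun i _ => Finset.sum_congr rfl fun j _ => ?_
    push_cast
    ring
  · simp only [Nat.succ_ne_zero, if_false, hm, ← Finset.sum_add_distrib, Finset.mul_sum]
    refine Finset.sum_congr rfl fun i _ => Finset.sum_congr rfl fun j _ => ?_
    push_cast
    ring

end Matrices

/-! ### Fourier series and the diffraction measure -/

/-- The character `k ↦ exp (-2πi m k)`. -/
def character (m : ℤ) (k : ℝ) : ℂ := Complex.exp (((-2 * Real.pi * k * m : ℝ) : ℂ) * Complex.I)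

theorem norm_character (m : ℤ) (k : ℝ) : ‖character m k‖ = 1 := Complex.norm_exp_ofReal_mul_I _

theorem continuous_character (m : ℤ) : Continuous (character m) := by
  unfold character
  fun_prop

theorem fourier_schwartz_intCast (φ : 𝓢(ℝ, ℂ)) (m : ℤ) :
    (𝓕 φ) (m : ℝ) = ∫ k, φ k * character m k := by
  refine (Real.fourier_real_eq_integral_exp_smul (φ : ℝ → ℂ) (m : ℝ)).trans ?_
  refine integral_congr_ae (ae_of_all _ fun k => ?_)
  simp only [smul_eq_mul, character]
  rw [mul_comm]

/-- With `z` the character at `1`, the terms `m ≥ 0` and `m < 0` form geometric series in `l z` and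
`l * conj z`. Over the common denominator `|1 - l z|²` they add up to the Poisson kernel. -/
theorem hasSum_pow_natAbs_mul_character {l : ℝ} (hl : |l| < 1) (k : ℝ) :
    HasSum (fun m : ℤ => ((l ^ m.natAbs : ℝ) : ℂ) * character m k)
      (radialPoissonKernel l k : ℂ) := by
  set z : ℂ := character 1 k with hz
  have hzn : ‖z‖ = 1 := norm_character _ _
  have hchar : ∀ n : ℕ, character n k = z ^ n := by
    intro n
    rw [hz, character, character, ← Complex.exp_nat_mul]
    congr 1
    push_cast
    ring
  have hchar' : ∀ n : ℕ, character (-(n + 1)) k = conj z ^ (n + 1) := by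
    intro n
    rw [hz, character, character, ← Complex.exp_conj, ← Complex.exp_nat_mul]
    congr 1
    rw [map_mul, Complex.conj_ofReal, Complex.conj_I]
    push_cast
    ring
  have hn1 : ‖(l : ℂ) * z‖ < 1 := by
    rwa [norm_mul, hzn, mul_one, Complex.norm_real]
  have hn2 : ‖(l : ℂ) * conj z‖ < 1 := by
    rwa [norm_mul, RCLike.norm_conj, hzn, mul_one, Complex.norm_real]
  have h1 := hasSum_geometric_of_norm_lt_one hn1
  have h2 := (hasSum_geometric_of_norm_lt_one hn2).mul_left ((l : ℂ) * conj z)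
  have hzz : z * conj z = 1 := by rw [Complex.mul_conj', hzn]; simp
  have hre : z + conj z = 2 * Real.cos (2 * Real.pi * k) := by
    rw [Complex.add_conj, hz, character, Complex.exp_ofReal_mul_I_re, ← Real.cos_neg]
    push_cast
    congr 2
    ring
  have hval : (1 - (l : ℂ) * z)⁻¹ + l * conj z * (1 - l * conj z)⁻¹ = radialPoissonKernel l k := by
    have hd1 : 1 - (l : ℂ) * z ≠ 0 := fun h0 => by
      rw [← sub_eq_zero.1 h0] at hn1; simp at hn1
    have hd2 : 1 - (l : ℂ) * conj z ≠ 0 := fun h0 => by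
      rw [← sub_eq_zero.1 h0] at hn2; simp at hn2
    have hden : ((1 - 2 * Real.cos (2 * Real.pi * k) * l + l ^ 2 : ℝ) : ℂ) =
        (1 - l * z) * (1 - l * conj z) := by
      have : (1 - l * z) * (1 - l * conj z) = 1 - (z + conj z) * l + l ^ 2 * (z * conj z) := by
        ring
      rw [this, hre, hzz]
      push_cast
      ring
    rw [radialPoissonKernel, Complex.ofReal_div, hden]
    field_simp
    push_cast
    linear_combination (-(l : ℂ) ^ 2) * hzz
  rw [← hval]
  refine HasSum.of_nat_of_neg_add_one ?_ ?_
  · refine Eq.mpr (congrArg (fun F : ℕ → ℂ => HasSum F _) (funext fun n => ?_)) h1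
    rw [hchar, Int.natAbs_natCast, Complex.ofReal_pow, mul_pow]
  · refine Eq.mpr (congrArg (fun F : ℕ → ℂ => HasSum F _) (funext fun n => ?_)) h2
    rw [hchar', Int.natAbs_neg, ← pow_succ', mul_pow, ← Complex.ofReal_pow]
    rfl

theorem summable_pow_natAbs {l : ℝ} (hl : |l| < 1) : Summable fun m : ℤ => l ^ m.natAbs := by
  have h : Summable fun n : ℕ => l ^ n := summable_geometric_of_abs_lt_one hl
  refine Summable.of_nat_of_neg_add_one (by simpa using h) ?_
  refine (summable_congr fun n => ?_).2 ((summable_nat_add_iff 1).2 h)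
  rw [Int.natAbs_neg]
  rfl

theorem summable_fourier_schwartz (φ : 𝓢(ℝ, ℂ)) : Summable fun m : ℤ => φ (m : ℝ) :=
  integrable_integerComb_iff.1 φ.integrable

/-- Poisson summation: the integer comb is its own Fourier transform. -/
theorem tsum_fourier_schwartz (φ : 𝓢(ℝ, ℂ)) : ∑' m : ℤ, (𝓕 φ) (m : ℝ) = ∑' m : ℤ, φ (m : ℝ) := by
  have h := SchwartzMap.tsum_eq_tsum_fourier φ 0
  simpa [zero_add] using h.symm

/-- Sum and integral may be exchanged because the characters have modulus one, so the `L¹` norms of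
the terms are `‖φ‖₁ ‖d m‖`, which is summable. -/
theorem tsum_mul_fourier_schwartz {d : ℤ → ℂ} (hd : Summable d) {f : ℝ → ℝ}
    (hf : ∀ k, HasSum (fun m => d m * character m k) (f k : ℂ)) (φ : 𝓢(ℝ, ℂ)) :
    ∑' m : ℤ, (𝓕 φ) (m : ℝ) * d m = ∫ k, φ k * f k := by
  have hint : ∀ m : ℤ, Integrable fun k => φ k * (d m * character m k) := fun m => by
    refine (φ.integrable (μ := volume)).mul_bdd (c := ‖d m‖)
      ((continuous_const.mul (continuous_character m)).aestronglyMeasurable)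
      (ae_of_all _ fun k => ?_)
    rw [norm_mul, norm_character, mul_one]
  have hnorm : ∀ m : ℤ, ∫ k, ‖φ k * (d m * character m k)‖ = (∫ k, ‖φ k‖) * ‖d m‖ := fun m => by
    rw [← integral_mul_const]
    simp only [norm_mul, norm_character, mul_one]
  have hsum : Summable fun m : ℤ => ∫ k, ‖φ k * (d m * character m k)‖ := by
    simp only [hnorm]
    exact hd.norm.mul_left _
  have h := hasSum_integral_of_summable_integral_norm hint hsum
  have h1 : ∀ k, ∑' m : ℤ, φ k * (d m * character m k) = φ k * f k := fun k =>
    ((hf k).mul_left (φ k)).tsum_eq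
  simp only [h1] at h
  rw [← h.tsum_eq]
  refine tsum_congr fun m => ?_
  rw [fourier_schwartz_intCast, ← integral_mul_const]
  refine integral_congr_ae (ae_of_all _ fun k => ?_)
  ring

theorem mutuallySingular_integerComb : integerComb ⟂ₘ (volume : Measure ℝ) := by
  have hc : (Set.range fun m : ℤ => (m : ℝ)).Countable := Set.countable_range _
  refine ⟨(Set.range fun m : ℤ => (m : ℝ))ᶜ, hc.measurableSet.compl, ?_, ?_⟩
  · rw [integerComb, Measure.sum_apply _ hc.measurableSet.compl, ENNReal.tsum_eq_zero]
    intro m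
    rw [Measure.dirac_apply' _ hc.measurableSet.compl]
    simp
  · rw [compl_compl]
    exact hc.measure_zero _

/-- The measure `A ∑ δ_k + f vol`. -/
def combAddDensity (A : ℝ) (f : ℝ → ℝ) : Measure ℝ :=
  ENNReal.ofReal A • integerComb + volume.withDensity fun k => ENNReal.ofReal (f k)

/-- The comb is singular to Lebesgue measure, so uniqueness of the Lebesgue decomposition applies.
-/
theorem acPart_combAddDensity (A : ℝ) {f : ℝ → ℝ} (hf : Continuous f) :
    acPart (combAddDensity A f) = volume.withDensity fun k => ENNReal.ofReal (f k) :=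
  (Measure.eq_withDensity_rnDeriv (by fun_prop)
    ((mutuallySingular_integerComb.smul (ENNReal.ofReal A))) rfl).symm

theorem isLocallyFiniteMeasure_combAddDensity (A : ℝ) {f : ℝ → ℝ} (hf : Continuous f) :
    IsLocallyFiniteMeasure (combAddDensity A f) := by
  have h1 : IsLocallyFiniteMeasure (ENNReal.ofReal A • integerComb) :=
    isLocallyFiniteMeasureSMulNNReal integerComb A.toNNReal
  have h2 : IsLocallyFiniteMeasure (volume.withDensity fun k => ENNReal.ofReal (f k)) :=
    IsLocallyFiniteMeasure.withDensity_ofReal hf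
  refine ⟨fun x => ?_⟩
  obtain ⟨s, hs, hs'⟩ := h1.1 x
  obtain ⟨t, ht, ht'⟩ := h2.1 x
  refine ⟨s ∩ t, inter_mem hs ht, ?_⟩
  rw [combAddDensity, Measure.add_apply]
  exact ENNReal.add_lt_top.2 ⟨(measure_mono Set.inter_subset_left).trans_lt hs',
    (measure_mono Set.inter_subset_right).trans_lt ht'⟩

theorem integrable_combAddDensity (A : ℝ) {f : ℝ → ℝ} (hf : Continuous f) (hf0 : ∀ k, 0 ≤ f k)
    {C : ℝ} (hC : ∀ k, |f k| ≤ C) (φ : 𝓢(ℝ, ℂ)) : Integrable φ (combAddDensity A f) := by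
  refine Integrable.add_measure (φ.integrable.smul_measure ENNReal.ofReal_ne_top) ?_
  rw [integrable_withDensity_iff_integrable_smul' (by fun_prop)
    (ae_of_all _ fun _ => ENNReal.ofReal_lt_top)]
  simp only [ENNReal.toReal_ofReal (hf0 _), Complex.real_smul]
  refine (φ.integrable (μ := volume)).bdd_mul (c := C)
    (Complex.continuous_ofReal.comp hf).aestronglyMeasurable (ae_of_all _ fun k => ?_)
  exact (Complex.norm_real _).trans_le (hC k)

theorem integral_combAddDensity {A : ℝ} (hA : 0 ≤ A) {f : ℝ → ℝ} (hf : Continuous f)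
    (hf0 : ∀ k, 0 ≤ f k) {C : ℝ} (hC : ∀ k, |f k| ≤ C) (φ : 𝓢(ℝ, ℂ)) :
    ∫ k, φ k ∂(combAddDensity A f) = A * ∑' m : ℤ, φ (m : ℝ) + ∫ k, φ k * f k := by
  have h := integrable_combAddDensity A hf hf0 hC φ
  rw [combAddDensity, integral_add_measure (h.mono_measure (Measure.le_add_right le_rfl))
    (h.mono_measure (Measure.le_add_left le_rfl)), integral_smul_measure,
    integral_integerComb (summable_fourier_schwartz φ), ENNReal.toReal_ofReal hA,
    integral_withDensity_eq_integral_toReal_smul (by fun_prop)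
      (ae_of_all _ fun _ => ENNReal.ofReal_lt_top), Complex.real_smul]
  congr 1
  refine integral_congr_ae (ae_of_all _ fun k => ?_)
  simp only [ENNReal.toReal_ofReal (hf0 k), Complex.real_smul]
  ring

namespace CMeasure

/-- A comb whose autocorrelation coefficients are a constant plus a summable sequence. -/
theorem isDiffraction_combAddDensity {w c d : ℤ → ℂ} {A C : ℝ} (hA : 0 ≤ A)
    (hnat : (weightedComb w).IsNaturalAutocorrelation (weightedComb c))
    (hc : ∀ m, c m = A + d m) (hd : Summable d) {f : ℝ → ℝ} (hf : Continuous f)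
    (hf0 : ∀ k, 0 ≤ f k) (hC : ∀ k, |f k| ≤ C)
    (hsum : ∀ k, HasSum (fun m => d m * character m k) (f k : ℂ)) :
    (weightedComb w).IsDiffraction (combAddDensity A f) := by
  have hlf := isLocallyFiniteMeasure_combAddDensity A hf
  obtain ⟨B, hB⟩ : ∃ B, ∀ m, ‖c m‖ ≤ B := by
    refine ⟨A + ∑' m, ‖d m‖, fun m => ?_⟩
    rw [hc]
    refine (norm_add_le _ _).trans (add_le_add ?_ ?_)
    · rw [Complex.norm_real, Real.norm_of_nonneg hA]
    · exact hd.norm.le_tsum m fun _ _ => norm_nonneg _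
  have hmeas : Measurable fun x : ℝ => c ⌊x⌋ :=
    (measurable_of_countable c).comp Int.measurable_floor
  have hmem : MemLp (fun x : ℝ => c ⌊x⌋) ⊤ integerComb :=
    memLp_top_of_bound hmeas.aestronglyMeasurable B (ae_of_all _ fun x => hB _)
  -- Bounded coefficients against a comb of temperate growth define a tempered distribution.
  have hrep : (weightedComb c).Represents (Lp.toTemperedDistribution hmem.toLp) := by
    intro φ
    refine ⟨(φ.integrable (μ := integerComb)).mul_bdd (c := B) hmeas.aestronglyMeasurable
      (ae_of_all _ fun x => hB _), ?_⟩
    rw [Lp.toTemperedDistribution_apply]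
    refine integral_congr_ae ?_
    filter_upwards [hmem.coeFn_toLp] with x hx
    rw [hx]
    rfl
  refine ⟨hlf, weightedComb c, Lp.toTemperedDistribution hmem.toLp, hnat, hrep, fun φ => ?_⟩
  have hint := integrable_combAddDensity A hf hf0 hC φ
  refine ⟨by simpa [ofMeasure] using hint, ?_⟩
  have h1 : (ofMeasure (combAddDensity A f)).eval φ = ∫ k, φ k ∂(combAddDensity A f) := by
    simp [ofMeasure, eval]
  have h3 := summable_fourier_schwartz (𝓕 φ)
  have h6 := tsum_fourier_schwartz φ
  have h7 := tsum_mul_fourier_schwartz hd hsum φ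
  -- Poisson summation and the Fubini step move everything to `ψ = 𝓕 φ`; what remains is `∑ ψ c = A
  -- ∑ ψ + ∑ ψ d`.
  rw [TemperedDistribution.fourier_apply, h1, integral_combAddDensity hA hf hf0 hC, ← h6, ← h7]
  generalize (𝓕 φ : 𝓢(ℝ, ℂ)) = ψ at h3 ⊢
  have h2 : Summable fun m : ℤ => ψ (m : ℝ) * c ⌊(m : ℝ)⌋ :=
    integrable_integerComb_iff.1 (hrep ψ).1
  have h4 : Summable fun m : ℤ => ψ (m : ℝ) * d m := by
    refine (h2.sub (h3.mul_right (A : ℂ))).congr fun m => ?_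
    rw [Int.floor_intCast, hc]
    ring
  have h5 : (weightedComb c).eval ψ = ∑' m : ℤ, ψ (m : ℝ) * c ⌊(m : ℝ)⌋ :=
    integral_integerComb (F := fun x => ψ x * c ⌊x⌋) h2
  rw [(hrep ψ).2, h5, ← tsum_mul_left, ← (h3.mul_left _).tsum_add h4]
  refine tsum_congr fun m => ?_
  rw [Int.floor_intCast, hc]
  ring

end CMeasure

/-! ### The stationary Markov process -/

section Markov

/-- The action of a real matrix on complex vectors. -/
def act {n : ℕ} (A : Matrix (Fin n) (Fin n) ℝ) (u : Fin n → ℂ) (i : Fin n) : ℂ :=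
  ∑ j, (A i j : ℂ) * u j

theorem act_one {n : ℕ} (u : Fin n → ℂ) : act 1 u = u := by
  funext i
  rw [act, Finset.sum_eq_single i]
  · simp
  · intro j _ hj; simp [Matrix.one_apply_ne hj.symm]
  · simp

theorem act_mul {n : ℕ} (A B : Matrix (Fin n) (Fin n) ℝ) (u : Fin n → ℂ) :
    act (A * B) u = act A (act B u) := by
  funext i
  simp only [act, mul_apply, Complex.ofReal_sum, Complex.ofReal_mul, Finset.sum_mul,
    Finset.mul_sum]
  rw [Finset.sum_comm]
  exact Finset.sum_congr rfl fun j _ => Finset.sum_congr rfl fun k _ => by ring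

variable {n : ℕ} [Nonempty (Fin n)] {Ω : Type*} {h : Fin n → ℂ} {η : ℤ → Ω → ℂ}

/-- The index of the state of the process at time `m`. -/
def stateIndex (h : Fin n → ℂ) (η : ℤ → Ω → ℂ) (m : ℤ) (ω : Ω) : Fin n :=
  Function.invFun h (η m ω)

/-- `F` is a function of the states of the process at the times `a, …, a + l`. -/
def DependsOnWindow (h : Fin n → ℂ) (η : ℤ → Ω → ℂ) (a : ℤ) (l : ℕ) (F : Ω → ℂ) : Prop :=
  ∃ G : (Fin (l + 1) → Fin n) → ℂ, ∀ ω, F ω = G fun j => stateIndex h η (a + (j : ℕ)) ω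

namespace DependsOnWindow

variable {a : ℤ} {l : ℕ} {F F' : Ω → ℂ}

theorem coord {t : ℕ} (ht : t ≤ l) (u : Fin n → ℂ) :
    DependsOnWindow h η a l fun ω => u (stateIndex h η (a + t) ω) :=
  ⟨fun i => u (i ⟨t, Nat.lt_succ_of_le ht⟩), fun _ => rfl⟩

theorem const (c : ℂ) : DependsOnWindow h η a l fun _ => c := ⟨fun _ => c, fun _ => rfl⟩

theorem mul (hF : DependsOnWindow h η a l F) (hF' : DependsOnWindow h η a l F') :
    DependsOnWindow h η a l fun ω => F ω * F' ω := by
  obtain ⟨G, hG⟩ := hF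
  obtain ⟨G', hG'⟩ := hF'
  exact ⟨fun i => G i * G' i, fun ω => congrArg₂ (· * ·) (hG ω) (hG' ω)⟩

theorem sub (hF : DependsOnWindow h η a l F) (hF' : DependsOnWindow h η a l F') :
    DependsOnWindow h η a l fun ω => F ω - F' ω := by
  obtain ⟨G, hG⟩ := hF
  obtain ⟨G', hG'⟩ := hF'
  exact ⟨fun i => G i - G' i, fun ω => congrArg₂ (· - ·) (hG ω) (hG' ω)⟩

theorem mono (hF : DependsOnWindow h η a l F) {l' : ℕ} (hl : l ≤ l') :
    DependsOnWindow h η a l' F := by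
  obtain ⟨G, hG⟩ := hF
  exact ⟨fun i => G fun j => i (Fin.castLE (Nat.succ_le_succ hl) j), fun ω => by rw [hG]; rfl⟩

end DependsOnWindow

namespace IsStationaryMarkovProcess

variable [MeasurableSpace Ω] {P : Measure Ω} [IsProbabilityMeasure P]
  {M : Matrix (Fin n) (Fin n) ℝ} {p : Fin n → ℝ}

omit [Nonempty (Fin n)] in
-- The cylinder probabilities at a single time already sum to `1`.
theorem ae_mem_range (hη : IsStationaryMarkovProcess P h M p η) (hh : Function.Injective h)
    (hp_prob : p ∈ stdSimplex ℝ (Fin n)) : ∀ᵐ ω ∂P, ∀ m, η m ω ∈ Set.range h := by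
  rw [ae_all_iff]
  intro m
  have hmeas : ∀ i, MeasurableSet {ω | η m ω = h i} := fun i =>
    hη.measurable m (measurableSet_singleton (h i))
  have h1 : ∀ i, P {ω | η m ω = h i} = ENNReal.ofReal (p i) := by
    intro i
    have := hη.cylinder m 0 fun _ => i
    simpa using this
  have h2 : P (⋃ i, {ω | η m ω = h i}) = 1 := by
    rw [measure_iUnion _ hmeas, tsum_fintype]
    · simp only [h1]
      rw [← ENNReal.ofReal_sum_of_nonneg fun i _ => hp_prob.1 i, hp_prob.2, ENNReal.ofReal_one]
    · intro i j hij
      rw [Function.onFun, Set.disjoint_left]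
      intro ω hi hj
      exact hij (hh (hi.symm.trans hj))
  have h3 := (mem_ae_iff_prob_eq_one (MeasurableSet.iUnion hmeas)).2 h2
  filter_upwards [h3] with ω hω
  obtain ⟨i, hi⟩ := Set.mem_iUnion.1 hω
  exact ⟨i, hi.symm⟩

theorem ae_apply_stateIndex (hη : IsStationaryMarkovProcess P h M p η)
    (hh : Function.Injective h) (hp_prob : p ∈ stdSimplex ℝ (Fin n)) :
    ∀ᵐ ω ∂P, ∀ m, h (stateIndex h η m ω) = η m ω := by
  filter_upwards [hη.ae_mem_range hh hp_prob] with ω hω m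
  exact Function.invFun_eq (hω m)

/-- Up to a null set the finitely many cylinders over the window partition `Ω`, and the integrand is
constant on each. -/
theorem integrable_and_integral_path (hη : IsStationaryMarkovProcess P h M p η)
    (hh : Function.Injective h) (hp_prob : p ∈ stdSimplex ℝ (Fin n))
    (hM : M ∈ Matrix.rowStochastic ℝ (Fin n)) (a : ℤ) (l : ℕ)
    (G : (Fin (l + 1) → Fin n) → ℂ) :
    Integrable (fun ω => G fun j => stateIndex h η (a + (j : ℕ)) ω) P ∧
    ∫ ω, G (fun j => stateIndex h η (a + (j : ℕ)) ω) ∂P =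
      ∑ i : Fin (l + 1) → Fin n,
        ((p (i 0) * ∏ j : Fin l, M (i j.castSucc) (i j.succ) : ℝ) : ℂ) * G i := by
  classical
  set A : (Fin (l + 1) → Fin n) → Set Ω := fun i =>
    {ω | ∀ j : Fin (l + 1), η (a + (j : ℕ)) ω = h (i j)} with hA
  have hmeas : ∀ i, MeasurableSet (A i) := fun i => by
    rw [hA]
    simp only [Set.ofPred_forall]
    exact MeasurableSet.iInter fun j => hη.measurable _ (measurableSet_singleton (h (i j)))
  have hae : (fun ω => G fun j => stateIndex h η (a + (j : ℕ)) ω) =ᵐ[P]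
      fun ω => ∑ i, (A i).indicator (fun _ => G i) ω := by
    filter_upwards [hη.ae_apply_stateIndex hh hp_prob] with ω hω
    rw [Finset.sum_eq_single fun j : Fin (l + 1) => stateIndex h η (a + (j : ℕ)) ω]
    · rw [Set.indicator_of_mem]
      exact fun j => (hω _).symm
    · intro i _ hi
      refine Set.indicator_of_notMem (fun hmem => hi ?_) _
      funext j
      exact hh ((hmem j).symm.trans (hω _).symm)
    · simp
  have hint : ∀ i, Integrable ((A i).indicator fun _ => G i) P := fun i =>
    (integrable_const (G i)).indicator (hmeas i)
  refine ⟨(integrable_finsetSum _ fun i _ => hint i).congr hae.symm, ?_⟩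
  rw [integral_congr_ae hae, integral_finsetSum _ fun i _ => hint i]
  refine Finset.sum_congr rfl fun i _ => ?_
  have hnn : 0 ≤ p (i 0) * ∏ j : Fin l, M (i j.castSucc) (i j.succ) :=
    mul_nonneg (hp_prob.1 _) (Finset.prod_nonneg fun j _ => nonneg_of_mem_rowStochastic hM)
  rw [integral_indicator_const _ (hmeas i), Measure.real, hA, hη.cylinder,
    ENNReal.toReal_ofReal hnn, Complex.real_smul]

theorem integrable_of_dependsOnWindow (hη : IsStationaryMarkovProcess P h M p η)
    (hh : Function.Injective h) (hp_prob : p ∈ stdSimplex ℝ (Fin n))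
    (hM : M ∈ Matrix.rowStochastic ℝ (Fin n)) {a : ℤ} {l : ℕ} {F : Ω → ℂ}
    (hF : DependsOnWindow h η a l F) : Integrable F P := by
  obtain ⟨G, hG⟩ := hF
  rw [funext hG]
  exact (hη.integrable_and_integral_path hh hp_prob hM a l G).1

/-- The Markov property, for one time step. -/
theorem integral_mul_succ (hη : IsStationaryMarkovProcess P h M p η)
    (hh : Function.Injective h) (hp_prob : p ∈ stdSimplex ℝ (Fin n))
    (hM : M ∈ Matrix.rowStochastic ℝ (Fin n)) {a : ℤ} {l : ℕ} {F : Ω → ℂ}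
    (hF : DependsOnWindow h η a l F) (u : Fin n → ℂ) :
    ∫ ω, F ω * u (stateIndex h η (a + (l + 1 : ℕ)) ω) ∂P =
      ∫ ω, F ω * act M u (stateIndex h η (a + l) ω) ∂P := by
  obtain ⟨G, hG⟩ := hF
  have h1 := (hη.integrable_and_integral_path hh hp_prob hM a (l + 1)
    fun i => G (fun j => i j.castSucc) * u (i (Fin.last _))).2
  have h2 := (hη.integrable_and_integral_path hh hp_prob hM a l
    fun i => G i * act M u (i (Fin.last _))).2
  simp only [Fin.val_castSucc, Fin.val_last] at h1 h2
  simp only [hG]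
  -- Splitting off the last state of a path and summing over it produces `act M u`.
  rw [h1, h2, ← (Fin.snocEquiv fun _ => Fin n).sum_comp, Fintype.sum_prod_type, Finset.sum_comm]
  refine Finset.sum_congr rfl fun i _ => ?_
  simp only [act, Finset.mul_sum]
  refine Finset.sum_congr rfl fun x _ => ?_
  simp only [Fin.snocEquiv, Equiv.coe_fn_mk, Fin.prod_univ_castSucc, Fin.snoc_castSucc,
    Fin.snoc_last, Fin.succ_last, Fin.succ_castSucc]
  have h0 : (Fin.snoc i x : Fin (l + 1 + 1) → Fin n) 0 = i 0 := by
    rw [← Fin.castSucc_zero, Fin.snoc_castSucc]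
  rw [h0]
  push_cast
  ring

/-- The Markov property. -/
theorem integral_mul_add (hη : IsStationaryMarkovProcess P h M p η)
    (hh : Function.Injective h) (hp_prob : p ∈ stdSimplex ℝ (Fin n))
    (hM : M ∈ Matrix.rowStochastic ℝ (Fin n)) {a : ℤ} {l : ℕ} {F : Ω → ℂ}
    (hF : DependsOnWindow h η a l F) (s : ℕ) (u : Fin n → ℂ) :
    ∫ ω, F ω * u (stateIndex h η (a + (l + s : ℕ)) ω) ∂P =
      ∫ ω, F ω * act (M ^ s) u (stateIndex h η (a + l) ω) ∂P := by
  induction s generalizing u with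
  | zero => rw [pow_zero, act_one, add_zero]
  | succ s ih =>
    rw [pow_succ, act_mul, ← ih, ← add_assoc,
      hη.integral_mul_succ hh hp_prob hM (hF.mono (Nat.le_add_right l s)) u]

omit [Nonempty (Fin n)] in
-- As `q` has `p`-mean zero, `M ^ s` may be replaced by `M ^ s - 𝟙 pᵗ`, which decays.
theorem norm_act_pow_le {C r : ℝ}
    (hCr : ∀ (s : ℕ) (i j : Fin n), |(M ^ s) i j - p j| ≤ C * r ^ s)
    {q : Fin n → ℂ} (hq : ∑ j, (p j : ℂ) * q j = 0) (s : ℕ) (i : Fin n) :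
    ‖act (M ^ s) q i‖ ≤ C * (∑ j, ‖q j‖) * r ^ s := by
  have h1 : act (M ^ s) q i = ∑ j, (((M ^ s) i j - p j : ℝ) : ℂ) * q j := by
    simp only [Complex.ofReal_sub, sub_mul, Finset.sum_sub_distrib, hq, sub_zero]
    rfl
  rw [h1, mul_right_comm, Finset.mul_sum]
  refine (norm_sum_le _ _).trans (Finset.sum_le_sum fun j _ => ?_)
  rw [norm_mul, Complex.norm_real, Real.norm_eq_abs]
  exact mul_le_mul_of_nonneg_right (hCr s i j) (norm_nonneg _)

/-- The deviation of `η (k + m) * conj (η k)` from `c`, in terms of the state indices. -/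
def lagDeviation (h : Fin n → ℂ) (η : ℤ → Ω → ℂ) (m : ℕ) (c : ℂ) (k : ℤ) (ω : Ω) : ℂ :=
  h (stateIndex h η (k + m) ω) * conj (h (stateIndex h η k ω)) - c

omit [MeasurableSpace Ω] in
theorem dependsOnWindow_lagDeviation (m : ℕ) (c : ℂ) (a : ℤ) {t l : ℕ} (hl : t + m ≤ l) :
    DependsOnWindow h η a l (lagDeviation h η m c (a + t)) := by
  refine DependsOnWindow.sub (DependsOnWindow.mul ?_ ?_) (DependsOnWindow.const c)
  · have := DependsOnWindow.coord (h := h) (η := η) (a := a) hl h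
    push_cast at this
    simpa only [add_assoc] using this
  · exact DependsOnWindow.coord (h := h) (η := η) (a := a) (by omega) fun x => conj (h x)

omit [MeasurableSpace Ω] in
theorem norm_lagDeviation_le (m : ℕ) (c : ℂ) (k : ℤ) (ω : Ω) :
    ‖lagDeviation h η m c k ω‖ ≤ (∑ i, ‖h i‖) ^ 2 + ‖c‖ := by
  have hb : ∀ i, ‖h i‖ ≤ ∑ i, ‖h i‖ := fun i =>
    Finset.single_le_sum (f := fun i => ‖h i‖) (fun _ _ => norm_nonneg _) (Finset.mem_univ i)
  refine (norm_sub_le _ _).trans (add_le_add_left ?_ _)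
  rw [norm_mul, RCLike.norm_conj, sq]
  exact mul_le_mul (hb _) (hb _) (norm_nonneg _)
    ((norm_nonneg _).trans (hb (Classical.arbitrary _)))

/-- Exponential decay of the correlations of `η (k + m) * conj (η k)`. -/
theorem exists_norm_integral_lagDeviation_le (hη : IsStationaryMarkovProcess P h M p η)
    (hh : Function.Injective h) (hp_prob : p ∈ stdSimplex ℝ (Fin n))
    (hM : M ∈ Matrix.rowStochastic ℝ (Fin n)) {C r : ℝ} (hC : 0 ≤ C) (hr : 0 < r) (hr1 : r < 1)
    (hCr : ∀ (s : ℕ) (i j : Fin n), |(M ^ s) i j - p j| ≤ C * r ^ s) (m : ℕ) {c : ℂ}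
    (hc : ∑ i, (p i : ℂ) * (conj (h i) * act (M ^ m) h i) = c) :
    ∃ K, 0 ≤ K ∧ ∀ j k : ℤ,
      ‖∫ ω, lagDeviation h η m c j ω * conj (lagDeviation h η m c k ω) ∂P‖ ≤
        K * r ^ (j - k).natAbs := by
  set B : ℝ := (∑ i, ‖h i‖) ^ 2 + ‖c‖ with hB
  have hB0 : 0 ≤ B := by positivity
  -- This is the conjugated deviation at time `k` averaged over the `m` steps after `k`, given the
  -- state at `k`. The choice of `c` gives it `p`-mean zero.
  set q : Fin n → ℂ := fun i => h i * act (M ^ m) (fun x => conj (h x)) i - conj c with hq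
  have hconj : ∀ i, act (M ^ m) (fun x => conj (h x)) i = conj (act (M ^ m) h i) := fun i => by
    simp only [act, map_sum, map_mul, Complex.conj_ofReal]
  have hq0 : ∑ j, (p j : ℂ) * q j = 0 := by
    have h1 : ∑ j, (p j : ℂ) = 1 := by exact_mod_cast hp_prob.2
    simp only [hq, mul_sub, Finset.sum_sub_distrib, ← Finset.sum_mul, h1, one_mul, hconj]
    rw [← hc, map_sum, sub_eq_zero]
    refine Finset.sum_congr rfl fun i _ => ?_
    simp only [map_mul, Complex.conj_ofReal, Complex.conj_conj]
  -- Windows of length `m` at distance `t ≥ m` decorrelate only like `r ^ (t - m)`, which costs the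
  -- factor `1 / r ^ m`. For `t < m` the trivial bound `B * B` suffices, since then `r ^ m ≤ r ^ t`.
  set K : ℝ := (B * (C * ∑ j, ‖q j‖) + B * B) / r ^ m with hK
  have hK0 : 0 ≤ K := by positivity
  have key : ∀ (a : ℤ) (t : ℕ),
      ‖∫ ω, lagDeviation h η m c a ω * conj (lagDeviation h η m c (a + t) ω) ∂P‖ ≤ K * r ^ t := by
    intro a t
    rcases le_or_gt m t with hmt | hmt
    · obtain ⟨s, rfl⟩ := Nat.exists_eq_add_of_le hmt
      have hY : DependsOnWindow h η a m (lagDeviation h η m c a) := by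
        simpa using dependsOnWindow_lagDeviation (h := h) (η := η) m c a (t := 0) (l := m)
          (by omega)
      have hY' := hY.mono (Nat.le_add_right m s)
      have hx : DependsOnWindow h η a (m + s) fun ω => h (stateIndex h η (a + (m + s : ℕ)) ω) :=
        DependsOnWindow.coord le_rfl h
      have e1 := hη.integral_mul_add hh hp_prob hM (hY'.mul hx) m fun x => conj (h x)
      have e2 := hη.integral_mul_add hh hp_prob hM hY s q
      have i1 := hη.integrable_of_dependsOnWindow hh hp_prob hM
        (((hY'.mul hx).mono (Nat.le_add_right _ m)).mul
          (DependsOnWindow.coord le_rfl fun x => conj (h x)))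
      have i2 := hη.integrable_of_dependsOnWindow hh hp_prob hM
        ((hY'.mul hx).mul (DependsOnWindow.coord le_rfl
          (act (M ^ m) fun x => conj (h x))))
      have i3 := hη.integrable_of_dependsOnWindow hh hp_prob hM
        (hY.mul (DependsOnWindow.const (conj c)))
      have e3 : ∫ ω, lagDeviation h η m c a ω *
            conj (lagDeviation h η m c (a + (m + s : ℕ)) ω) ∂P =
          ∫ ω, lagDeviation h η m c a ω * q (stateIndex h η (a + (m + s : ℕ)) ω) ∂P := by
        calc _ = ∫ ω, (lagDeviation h η m c a ω * h (stateIndex h η (a + (m + s : ℕ)) ω) *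
                conj (h (stateIndex h η (a + (m + s + m : ℕ)) ω)) -
                lagDeviation h η m c a ω * conj c) ∂P := by
              refine integral_congr_ae (ae_of_all _ fun ω => ?_)
              have ht : a + ((m + s : ℕ) : ℤ) + (m : ℤ) = a + ((m + s + m : ℕ) : ℤ) := by
                push_cast; ring
              simp only [lagDeviation, map_sub, map_mul, Complex.conj_conj, ht]
              ring
          _ = _ := by
              rw [integral_sub i1 i3, e1, ← integral_sub i2 i3]
              refine integral_congr_ae (ae_of_all _ fun ω => ?_)
              simp only [hq]
              ring
      rw [e3, e2]
      have hbd : ∀ ω, ‖lagDeviation h η m c a ω * act (M ^ s) q (stateIndex h η (a + m) ω)‖ ≤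
          B * (C * (∑ j, ‖q j‖) * r ^ s) := fun ω => by
        rw [norm_mul]
        exact mul_le_mul (norm_lagDeviation_le m c a ω) (norm_act_pow_le hCr hq0 s _)
          (norm_nonneg _) hB0
      refine (norm_integral_le_of_norm_le_const (ae_of_all _ hbd)).trans ?_
      rw [probReal_univ, mul_one, hK, pow_add, div_mul_eq_mul_div, le_div_iff₀ (by positivity)]
      nlinarith [mul_nonneg (mul_nonneg hB0 hB0) (mul_nonneg (pow_pos hr m).le (pow_pos hr s).le)]
    · have hbd : ∀ ω, ‖lagDeviation h η m c a ω * conj (lagDeviation h η m c (a + t) ω)‖ ≤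
          B * B := fun ω => by
        rw [norm_mul, RCLike.norm_conj]
        exact mul_le_mul (norm_lagDeviation_le m c a ω) (norm_lagDeviation_le m c _ ω)
          (norm_nonneg _) hB0
      refine (norm_integral_le_of_norm_le_const (ae_of_all _ hbd)).trans ?_
      rw [probReal_univ, mul_one, hK, div_mul_eq_mul_div, le_div_iff₀ (by positivity)]
      have h1 : r ^ m ≤ r ^ t := pow_le_pow_of_le_one hr.le hr1.le hmt.le
      have h2 : 0 ≤ B * (C * ∑ j, ‖q j‖) * r ^ t := by positivity
      nlinarith [mul_le_mul_of_nonneg_left h1 (mul_nonneg hB0 hB0)]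
  refine ⟨K, hK0, fun j k => ?_⟩
  rcases le_total j k with hjk | hjk
  · obtain ⟨t, rfl⟩ := Int.le.dest hjk
    simpa using key j t
  · obtain ⟨t, rfl⟩ := Int.le.dest hjk
    have h1 : ∫ ω, lagDeviation h η m c (k + t) ω * conj (lagDeviation h η m c k ω) ∂P =
        conj (∫ ω, lagDeviation h η m c k ω * conj (lagDeviation h η m c (k + t) ω) ∂P) := by
      rw [← integral_conj]
      refine integral_congr_ae (ae_of_all _ fun ω => ?_)
      simp only [map_mul, Complex.conj_conj]
      ring
    rw [h1, RCLike.norm_conj]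
    simpa using key k t

end IsStationaryMarkovProcess
end Markov

/-! ### A strong law of large numbers for weakly correlated sequences -/

section StrongLaw

variable {Ω : Type*} [MeasurableSpace Ω] {P : Measure Ω}

theorem summable_pow_natAbs_sub {r : ℝ} (hr : 0 < r) (hr1 : r < 1) (k : ℤ) :
    Summable (fun j : ℤ => r ^ (j - k).natAbs) ∧
      ∑' j : ℤ, r ^ (j - k).natAbs = ∑' j : ℤ, r ^ j.natAbs := by
  have h := summable_pow_natAbs (abs_lt.2 ⟨by linarith, hr1⟩ : |r| < 1)
  have h1 := (Equiv.subRight k).summable_iff (f := fun j : ℤ => r ^ j.natAbs)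
  have h2 := (Equiv.subRight k).tsum_eq fun j : ℤ => r ^ j.natAbs
  simp only [Function.comp_def, Equiv.subRight_apply] at h1 h2
  exact ⟨h1.2 h, h2⟩

/-- The second moment of a sum of weakly correlated variables grows at most linearly. -/
theorem integrable_and_integral_norm_sq_sum_le {Y : ℤ → Ω → ℂ} {K r : ℝ} (hK : 0 ≤ K)
    (hr : 0 < r) (hr1 : r < 1)
    (hint : ∀ j k, Integrable (fun ω => Y j ω * conj (Y k ω)) P)
    (hcov : ∀ j k, ‖∫ ω, Y j ω * conj (Y k ω) ∂P‖ ≤ K * r ^ (j - k).natAbs) (I : Finset ℤ) :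
    Integrable (fun ω => ‖∑ j ∈ I, Y j ω‖ ^ 2) P ∧
      ∫ ω, ‖∑ j ∈ I, Y j ω‖ ^ 2 ∂P ≤ I.card * (K * ∑' j : ℤ, r ^ j.natAbs) := by
  have hsq : ∀ ω, ((‖∑ j ∈ I, Y j ω‖ ^ 2 : ℝ) : ℂ) =
      ∑ k ∈ I, ∑ j ∈ I, Y j ω * conj (Y k ω) := by
    intro ω
    push_cast
    rw [← Complex.mul_conj', map_sum, Finset.sum_mul_sum, Finset.sum_comm]
  have hintS : Integrable (fun ω => ∑ k ∈ I, ∑ j ∈ I, Y j ω * conj (Y k ω)) P :=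
    integrable_finsetSum _ fun k _ => integrable_finsetSum _ fun j _ => hint j k
  have hre : ∀ ω, ‖∑ j ∈ I, Y j ω‖ ^ 2 = (∑ k ∈ I, ∑ j ∈ I, Y j ω * conj (Y k ω)).re := by
    intro ω
    rw [← hsq, Complex.ofReal_re]
  have hint2 : Integrable (fun ω => ‖∑ j ∈ I, Y j ω‖ ^ 2) P := by
    rw [funext hre]
    exact hintS.re
  refine ⟨hint2, ?_⟩
  have hcast : ((∫ ω, ‖∑ j ∈ I, Y j ω‖ ^ 2 ∂P : ℝ) : ℂ) =
      ∑ k ∈ I, ∑ j ∈ I, ∫ ω, Y j ω * conj (Y k ω) ∂P := by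
    rw [← integral_complex_ofReal, funext hsq, integral_finsetSum _ fun k _ =>
      integrable_finsetSum _ fun j _ => hint j k]
    exact Finset.sum_congr rfl fun k _ => integral_finsetSum _ fun j _ => hint j k
  calc _ ≤ ‖((∫ ω, ‖∑ j ∈ I, Y j ω‖ ^ 2 ∂P : ℝ) : ℂ)‖ := by
        rw [Complex.norm_real]
        exact le_abs_self _
    _ ≤ ∑ k ∈ I, ∑ j ∈ I, K * r ^ (j - k).natAbs := by
        rw [hcast]
        refine (norm_sum_le _ _).trans (Finset.sum_le_sum fun k _ => ?_)
        exact (norm_sum_le _ _).trans (Finset.sum_le_sum fun j _ => hcov j k)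
    -- Extending the inner sum to all integers gives a bound independent of `k`.
    _ ≤ ∑ k ∈ I, K * ∑' j : ℤ, r ^ j.natAbs := by
        refine Finset.sum_le_sum fun k _ => ?_
        obtain ⟨h1, h2⟩ := summable_pow_natAbs_sub hr hr1 k
        rw [← Finset.mul_sum, ← h2]
        exact mul_le_mul_of_nonneg_left (h1.sum_le_tsum _ fun _ _ => by positivity) hK
    _ = _ := by rw [Finset.sum_const, nsmul_eq_mul]

/-- Convergence along the squares, by the Borel–Cantelli argument. -/
theorem ae_tendsto_square {T : ℕ → Ω → ℂ} {C : ℝ}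
    (hint : ∀ N, Integrable (fun ω => ‖T N ω‖ ^ 2) P)
    (hle : ∀ N, ∫ ω, ‖T N ω‖ ^ 2 ∂P ≤ C * (N + 1)) :
    ∀ᵐ ω ∂P, Tendsto (fun j : ℕ => ‖T (j ^ 2) ω‖ / (j : ℝ) ^ 2) atTop (𝓝 0) := by
  have hC : 0 ≤ C := by
    have h1 : 0 ≤ ∫ ω, ‖T 0 ω‖ ^ 2 ∂P := integral_nonneg fun _ => by positivity
    have h2 := hle 0
    simp only [Nat.cast_zero, zero_add, mul_one] at h2
    linarith
  set F : ℕ → Ω → ℝ := fun j ω => (‖T (j ^ 2) ω‖ / (j : ℝ) ^ 2) ^ 2 with hF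
  have hFint : ∀ j, Integrable (F j) P := fun j => by
    simp only [hF, div_pow]
    exact (hint (j ^ 2)).div_const _
  -- Along squares the normalised second moment is at most `C (j² + 1) / j⁴ ≤ 2C / j²`, a summable
  -- bound; thus `∑ F j` is finite almost everywhere and its terms tend to zero. At `j = 0` both
  -- sides are zero by division by zero.
  have hFle : ∀ j, ∫ ω, F j ω ∂P ≤ 2 * C * (1 / (j : ℝ) ^ 2) := by
    intro j
    simp only [hF, div_pow]
    rw [integral_div]
    rcases Nat.eq_zero_or_pos j with rfl | hj
    · simp
    · have hj1 : (1 : ℝ) ≤ (j : ℝ) ^ 2 := one_le_pow₀ (by exact_mod_cast hj)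
      rw [div_le_iff₀ (by positivity)]
      have h1 := hle (j ^ 2)
      push_cast at h1
      have h2 : 2 * C * (1 / (j : ℝ) ^ 2) * ((j : ℝ) ^ 2) ^ 2 = 2 * C * (j : ℝ) ^ 2 := by
        field_simp
      rw [h2]
      nlinarith
  have hsum : ∑' j, ∫⁻ ω, ENNReal.ofReal (F j ω) ∂P ≠ ⊤ := by
    have hs : Summable fun j : ℕ => 2 * C * (1 / (j : ℝ) ^ 2) :=
      (Real.summable_one_div_nat_pow.2 one_lt_two).mul_left _
    refine ne_top_of_le_ne_top hs.tsum_ofReal_ne_top (ENNReal.tsum_le_tsum fun j => ?_)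
    rw [← ofReal_integral_eq_lintegral_ofReal (hFint j) (ae_of_all _ fun ω => by positivity)]
    exact ENNReal.ofReal_le_ofReal (hFle j)
  have hmeas : ∀ j, AEMeasurable (fun ω => ENNReal.ofReal (F j ω)) P := fun j =>
    (hFint j).aemeasurable.ennreal_ofReal
  rw [← lintegral_tsum hmeas] at hsum
  filter_upwards [ae_lt_top' (AEMeasurable.tsum hmeas) hsum] with ω hω
  have h1 := ENNReal.tendsto_atTop_zero_of_tsum_ne_top hω.ne
  have h2 := ((ENNReal.tendsto_toReal ENNReal.zero_ne_top).comp h1)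
  have h3 := (Real.continuous_sqrt.tendsto _).comp h2
  simp only [ENNReal.toReal_zero, Real.sqrt_zero] at h3
  refine h3.congr fun j => ?_
  have hnn : 0 ≤ F j ω := by positivity
  simp only [Function.comp, ENNReal.toReal_ofReal hnn]
  exact Real.sqrt_sq (by positivity)

/-- For `j = Nat.sqrt N` one has `N - j² ≤ 2j`, so bounded increments move `T` by at most `2Bj` from
its value at `j²`, which is negligible against `j²`. -/
theorem ae_tendsto_inv_mul {T : ℕ → Ω → ℂ} {B C : ℝ}
    (hint : ∀ N, Integrable (fun ω => ‖T N ω‖ ^ 2) P)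
    (hle : ∀ N, ∫ ω, ‖T N ω‖ ^ 2 ∂P ≤ C * (N + 1))
    (hstep : ∀ N ω, ‖T (N + 1) ω - T N ω‖ ≤ B) :
    ∀ᵐ ω ∂P, Tendsto (fun N : ℕ => ((N : ℝ) : ℂ)⁻¹ * T N ω) atTop (𝓝 0) := by
  filter_upwards [ae_tendsto_square hint hle] with ω hω
  have hB : 0 ≤ B := (norm_nonneg _).trans (hstep 0 ω)
  have hdist : ∀ N d : ℕ, ‖T (N + d) ω - T N ω‖ ≤ B * d := by
    intro N d
    induction d with
    | zero => simp
    | succ d ih =>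
      have h1 := norm_sub_le_norm_sub_add_norm_sub (T (N + (d + 1)) ω) (T (N + d) ω) (T N ω)
      have h2 := hstep (N + d) ω
      rw [← add_assoc] at h1
      push_cast
      rw [← add_assoc]
      linarith
  have hsqrt : Tendsto Nat.sqrt atTop atTop :=
    tendsto_atTop_atTop.2 fun b => ⟨b * b, fun a ha => Nat.le_sqrt.2 ha⟩
  have hlim : Tendsto (fun N : ℕ => ‖T (Nat.sqrt N ^ 2) ω‖ / (Nat.sqrt N : ℝ) ^ 2 +
      2 * B * (1 / (Nat.sqrt N : ℝ))) atTop (𝓝 (0 + 2 * B * 0)) :=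
    (hω.comp hsqrt).add ((tendsto_one_div_atTop_nhds_zero_nat.comp hsqrt).const_mul _)
  rw [mul_zero, add_zero] at hlim
  refine squeeze_zero_norm' ?_ hlim
  filter_upwards [eventually_ge_atTop 1] with N hN
  set j := Nat.sqrt N with hj
  have hj0 : 0 < j := Nat.sqrt_pos.2 hN
  have hjr : (0 : ℝ) < j := by exact_mod_cast hj0
  have hjN : j ^ 2 ≤ N := Nat.sqrt_le' N
  have hNj : N ≤ j ^ 2 + 2 * j := by
    have := Nat.sqrt_le_add N
    nlinarith
  have hjNr : (j : ℝ) ^ 2 ≤ N := by exact_mod_cast hjN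
  obtain ⟨d, hd⟩ := Nat.exists_eq_add_of_le hjN
  have hd2 : (d : ℝ) ≤ 2 * j := by
    have : d ≤ 2 * j := by omega
    exact_mod_cast this
  have hT : ‖T N ω‖ ≤ ‖T (j ^ 2) ω‖ + 2 * B * j := by
    have h1 := hdist (j ^ 2) d
    rw [← hd] at h1
    have h2 := norm_le_norm_add_norm_sub' (T N ω) (T (j ^ 2) ω)
    nlinarith
  rw [norm_mul, norm_inv, Complex.norm_real, Real.norm_natCast, inv_mul_eq_div]
  calc ‖T N ω‖ / N ≤ (‖T (j ^ 2) ω‖ + 2 * B * j) / (j : ℝ) ^ 2 :=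
        div_le_div₀ (by positivity) hT (by positivity) hjNr
    _ = _ := by field_simp

end StrongLaw

/-! ### Correlation averages of the Markov process -/

section Averages

variable {n : ℕ} {Ω : Type*} [MeasurableSpace Ω] {P : Measure Ω} [IsProbabilityMeasure P]
  {h : Fin n → ℂ} {η : ℤ → Ω → ℂ} {M : Matrix (Fin n) (Fin n) ℝ} {p : Fin n → ℝ}

/-- Only the points `-N - 1` and `N + 1 - m` can be new. -/
theorem norm_sum_Icc_succ_sub_le {Y : ℤ → ℂ} {B : ℝ} (hB : ∀ k, ‖Y k‖ ≤ B) (N m : ℕ) :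
    ‖∑ k ∈ Finset.Icc (-((N + 1 : ℕ) : ℤ)) ((N + 1 : ℕ) - m), Y k -
      ∑ k ∈ Finset.Icc (-(N : ℤ)) (N - m), Y k‖ ≤ 2 * B := by
  have hB0 : 0 ≤ B := (norm_nonneg _).trans (hB 0)
  have hsub : Finset.Icc (-(N : ℤ)) (N - m) ⊆
      Finset.Icc (-((N + 1 : ℕ) : ℤ)) ((N + 1 : ℕ) - m) := by
    intro k hk
    simp only [Finset.mem_Icc] at hk ⊢
    push_cast
    omega
  rw [← Finset.sum_sdiff hsub, add_sub_cancel_right]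
  refine (norm_sum_le _ _).trans ((Finset.sum_le_card_nsmul _ _ B fun k _ => hB k).trans ?_)
  rw [nsmul_eq_mul]
  refine mul_le_mul_of_nonneg_right ?_ hB0
  have hcard : (Finset.Icc (-((N + 1 : ℕ) : ℤ)) ((N + 1 : ℕ) - m) \
      Finset.Icc (-(N : ℤ)) (N - m)).card ≤ 2 := by
    refine (Finset.card_le_card (t := {-(N : ℤ) - 1, (N : ℤ) + 1 - m}) fun k hk => ?_).trans
      Finset.card_le_two
    simp only [Finset.mem_sdiff, Finset.mem_Icc, Finset.mem_insert, Finset.mem_singleton] at hk ⊢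
    push_cast at hk
    omega
  exact_mod_cast hcard

theorem tendsto_card_Icc (m : ℕ) :
    Tendsto (fun N : ℕ => ((N : ℝ) : ℂ)⁻¹ * ((Finset.Icc (-(N : ℤ)) (N - m)).card : ℂ)) atTop
      (𝓝 2) := by
  have h1 : Tendsto (fun N : ℕ => (((N : ℝ))⁻¹ : ℝ)) atTop (𝓝 0) :=
    tendsto_inv_atTop_nhds_zero_nat
  have h2 : Tendsto (fun N : ℕ => ((((N : ℝ))⁻¹ : ℝ) : ℂ)) atTop (𝓝 0) := by
    have := (Complex.continuous_ofReal.tendsto 0).comp h1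
    simpa only [Function.comp_def, Complex.ofReal_zero] using this
  have h3 := (h2.mul_const (1 - m : ℂ)).const_add 2
  rw [zero_mul, add_zero] at h3
  refine h3.congr' ?_
  filter_upwards [eventually_ge_atTop (m + 1)] with N hN
  have hcard : ((Finset.Icc (-(N : ℤ)) (N - m)).card : ℤ) = 2 * N + 1 - m := by
    rw [Int.card_Icc, Int.toNat_of_nonneg (by omega)]
    ring
  have hc : ((Finset.Icc (-(N : ℤ)) (N - m)).card : ℂ) = 2 * N + 1 - m := by exact_mod_cast hcard
  have hN0 : ((N : ℝ) : ℂ) ≠ 0 := by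
    exact_mod_cast (by omega : N ≠ 0)
  rw [hc, Complex.ofReal_inv]
  push_cast at hN0 ⊢
  field_simp
  ring

/-- The strong law makes the centred products average to zero; the window has `2N + 1 - m` points
for large `N`, so the constant `c` contributes `2 * c`. -/
theorem IsStationaryMarkovProcess.ae_tendsto_correlation
    (hη : IsStationaryMarkovProcess P h M p η) (hh : Function.Injective h)
    (hp_prob : p ∈ stdSimplex ℝ (Fin n)) (hM : M ∈ Matrix.rowStochastic ℝ (Fin n))
    {C r : ℝ} (hC : 0 ≤ C) (hr : 0 < r) (hr1 : r < 1)
    (hCr : ∀ (s : ℕ) (i j : Fin n), |(M ^ s) i j - p j| ≤ C * r ^ s) (m : ℕ) {c : ℂ}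
    (hc : ∑ i, (p i : ℂ) * (conj (h i) * act (M ^ m) h i) = c) :
    ∀ᵐ ω ∂P, Tendsto (fun N : ℕ => ((N : ℝ) : ℂ)⁻¹ *
      ∑ k ∈ Finset.Icc (-(N : ℤ)) (N - m), η (k + m) ω * conj (η k ω)) atTop (𝓝 (2 * c)) := by
  have hne : Nonempty (Fin n) := by
    by_contra hempty
    have := not_nonempty_iff.1 hempty
    simpa using hp_prob.2
  obtain ⟨K, hK, hcov⟩ :=
    hη.exists_norm_integral_lagDeviation_le hh hp_prob hM hC hr hr1 hCr m hc
  set Y := lagDeviation h η m c with hY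
  set B : ℝ := (∑ i, ‖h i‖) ^ 2 + ‖c‖ with hB
  have hYB : ∀ k ω, ‖Y k ω‖ ≤ B := IsStationaryMarkovProcess.norm_lagDeviation_le m c
  have hYdep : ∀ a, DependsOnWindow h η a m (Y a) := fun a => by
    simpa using IsStationaryMarkovProcess.dependsOnWindow_lagDeviation (h := h) (η := η) m c a
      (t := 0) (l := m) (by omega)
  have hYint : ∀ a, Integrable (Y a) P := fun a =>
    hη.integrable_of_dependsOnWindow hh hp_prob hM (hYdep a)
  have hint : ∀ j k, Integrable (fun ω => Y j ω * conj (Y k ω)) P := fun j k =>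
    (hYint j).mul_bdd (c := B)
      (Complex.continuous_conj.comp_aestronglyMeasurable (hYint k).aestronglyMeasurable)
      (ae_of_all _ fun ω => by rw [RCLike.norm_conj]; exact hYB k ω)
  have hvar := integrable_and_integral_norm_sq_sum_le hK hr hr1 hint hcov
  have hS : 0 ≤ K * ∑' j : ℤ, r ^ j.natAbs := mul_nonneg hK (tsum_nonneg fun _ => by positivity)
  have hlaw := ae_tendsto_inv_mul (P := P)
    (T := fun N ω => ∑ k ∈ Finset.Icc (-(N : ℤ)) (N - m), Y k ω) (B := 2 * B)
    (C := 2 * (K * ∑' j : ℤ, r ^ j.natAbs)) (fun N => (hvar _).1)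
    (fun N => by
      refine (hvar _).2.trans ?_
      have hcard : ((Finset.Icc (-(N : ℤ)) (N - m)).card : ℝ) ≤ 2 * (N + 1) := by
        have : (Finset.Icc (-(N : ℤ)) (N - m)).card ≤ 2 * (N + 1) := by
          rw [Int.card_Icc]
          omega
        exact_mod_cast this
      nlinarith [mul_le_mul_of_nonneg_right hcard hS])
    (fun N ω => norm_sum_Icc_succ_sub_le (fun k => hYB k ω) N m)
  filter_upwards [hlaw, hη.ae_apply_stateIndex hh hp_prob] with ω hω hidx
  have h1 := hω.add ((tendsto_card_Icc m).mul_const c)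
  rw [zero_add] at h1
  refine h1.congr fun N => ?_
  have : ∀ k, η (k + m) ω * conj (η k ω) = Y k ω + c := fun k => by
    simp only [hY, lagDeviation, hidx, sub_add_cancel]
  simp only [this, Finset.sum_add_distrib, Finset.sum_const, nsmul_eq_mul]
  ring

end Averages

/-! ### The diffuse part -/

theorem norm_sq_sum_mul_le_sum_radialPoissonKernel {n : ℕ} {l β : Fin n → ℝ} {v : Fin n → ℂ}
    (hl : ∀ i, |l i| < 1) (hlβ : ∀ i, l i * β i = 0) (hβ : ∑ i, β i ^ 2 = 1) (k : ℝ) :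
    ‖∑ i, (β i : ℂ) * v i‖ ^ 2 ≤ ∑ i, radialPoissonKernel (l i) k * ‖v i‖ ^ 2 := by
  -- Wherever `β i ≠ 0` one has `l i = 0` and the kernel equals `1`, so its root can be inserted
  -- freely before Cauchy–Schwarz.
  have h1 : ∀ i, ‖(β i : ℂ) * v i‖ = |β i| * (√(radialPoissonKernel (l i) k) * ‖v i‖) := by
    intro i
    rw [norm_mul, Complex.norm_real, Real.norm_eq_abs]
    rcases mul_eq_zero.1 (hlβ i) with h | h
    · simp [h, radialPoissonKernel]
    · simp [h]
  have h2 : ‖∑ i, (β i : ℂ) * v i‖ ≤ ∑ i, |β i| * (√(radialPoissonKernel (l i) k) * ‖v i‖) :=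
    (norm_sum_le _ _).trans_eq (Finset.sum_congr rfl fun i _ => h1 i)
  refine (pow_le_pow_left₀ (norm_nonneg _) h2 2).trans
    ((Finset.sum_mul_sq_le_sq_mul_sq _ _ _).trans_eq ?_)
  simp only [sq_abs, hβ, one_mul, mul_pow, Real.sq_sqrt (radialPoissonKernel_nonneg (hl _) k)]

theorem hasSum_single_zero_mul_character (z : ℂ) (k : ℝ) :
    HasSum (fun m : ℤ => (if m = 0 then z else 0) * character m k) z := by
  have h := hasSum_single (f := fun m : ℤ => (if m = 0 then z else 0) * character m k) 0
    (fun m hm => by simp [hm])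
  simpa [character] using h

end Diffraction

end

/-! ### The diffraction theorem -/

theorem mainTheorem4 {n : ℕ} (M : Matrix (Fin n) (Fin n) ℝ) (p : Fin n → ℝ) (h : Fin n → ℂ)
    (hM_stochastic : M ∈ Matrix.rowStochastic ℝ (Fin n))
    (hM_primitive : M.IsPrimitive)
    (hp_prob : p ∈ stdSimplex ℝ (Fin n))
    (hp_stationary : p ᵥ* M = p)
    (hM_reversible : Matrix.diagonal p * M = Mᵀ * Matrix.diagonal p)
    (hh : Function.Injective h)
    {Ω : Type*} [MeasurableSpace Ω] (P : Measure Ω) [IsProbabilityMeasure P]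
    (η : ℤ → Ω → ℂ) (hη : Diffraction.IsStationaryMarkovProcess P h M p η) :
    (∀ k : ℝ, IsUnit (Diffraction.denominator M p k)) ∧
    ∃ f : ℝ → ℝ,
      (∀ k : ℝ, (f k : ℂ) = Diffraction.diffuseFormula M p h k) ∧
      Continuous f ∧ Function.Periodic f 1 ∧ (∃ C : ℝ, ∀ k : ℝ, |f k| ≤ C) ∧
      (∀ k : ℝ, 0 ≤ f k) ∧
      ∀ᵐ ω ∂P, ∃ ρ : Measure ℝ,
        (Diffraction.CMeasure.weightedComb fun m => η m ω).IsDiffraction ρ ∧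
        ρ = ENNReal.ofReal (‖Diffraction.mean p h‖ ^ 2) • Diffraction.integerComb +
          Diffraction.acPart ρ ∧
        Diffraction.acPart ρ = volume.withDensity fun k => ENNReal.ofReal (f k) := by
  open Diffraction in
  have hpos := pos_of_stationary hM_primitive hp_prob hp_stationary
  obtain ⟨l, β, v, hl, hlβ, hβ, hmean, hunit, hform, hbraket⟩ :=
    exists_spectral_representation hM_stochastic hM_primitive hp_prob hp_stationary
      hM_reversible h
  obtain ⟨K, r, hK, hr, hr1, hKr⟩ :=
    exists_abs_pow_sub_le hM_stochastic hM_primitive hp_prob hp_stationary hM_reversible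
  set f : ℝ → ℝ := fun k => ∑ i, radialPoissonKernel (l i) k * ‖v i‖ ^ 2 - ‖mean p h‖ ^ 2 with hf
  have hcont : Continuous f :=
    (continuous_finsetSum _ fun i _ => (continuous_radialPoissonKernel (hl i)).mul_const _).sub
      continuous_const
  have hper : Function.Periodic f 1 := fun k => by
    simp only [hf, (periodic_radialPoissonKernel _) k]
  have hnonneg : ∀ k, 0 ≤ f k := fun k => by
    rw [hf, ← hmean]
    exact sub_nonneg.2 (norm_sq_sum_mul_le_sum_radialPoissonKernel hl hlβ hβ k)
  obtain ⟨C, hC⟩ : ∃ C : ℝ, ∀ k : ℝ, |f k| ≤ C := by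
    obtain ⟨C, hC⟩ := (hper.isBounded_of_continuous one_ne_zero hcont).exists_norm_le
    exact ⟨C, fun k => hC _ ⟨k, rfl⟩⟩
  refine ⟨hunit, f, fun k => (hform k).symm, hcont, hper, ⟨C, hC⟩, hnonneg, ?_⟩
  set A : ℝ := ‖mean p h‖ ^ 2 with hA
  -- The correction at `m = 0` offsets the constant `A`, since `S_1 ^ 0 = 1` gives the full second
  -- moment.
  set d : ℤ → ℂ := fun m =>
    ∑ i, ((l i ^ m.natAbs : ℝ) : ℂ) * ((‖v i‖ ^ 2 : ℝ) : ℂ) - if m = 0 then (A : ℂ) else 0 with hd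
  set c : ℤ → ℂ := fun m => A + d m with hc
  have hdsum : ∀ k, HasSum (fun m => d m * character m k) (f k : ℂ) := by
    intro k
    have h1 := (hasSum_sum fun i (_ : i ∈ Finset.univ) =>
      (hasSum_pow_natAbs_mul_character (hl i) k).mul_right ((‖v i‖ ^ 2 : ℝ) : ℂ)).sub
        (hasSum_single_zero_mul_character (A : ℂ) k)
    have h2 : (f k : ℂ) =
        ∑ i, (radialPoissonKernel (l i) k : ℂ) * ((‖v i‖ ^ 2 : ℝ) : ℂ) - (A : ℂ) := by
      simp only [hf]
      push_cast
      rfl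
    rw [h2]
    refine Eq.mpr (congrArg (fun F : ℤ → ℂ => HasSum F _) (funext fun m => ?_)) h1
    simp only [hd, sub_mul, Finset.sum_mul]
    congr 1
    exact Finset.sum_congr rfl fun i _ => by ring
  have hd_summable : Summable d := by
    -- At `k = 0` all characters equal `1`.
    have := (hdsum 0).summable
    simpa [character] using this
  have hc_conj : ∀ m, c (-m) = conj (c m) := by
    intro m
    simp only [hc, hd, Int.natAbs_neg, neg_eq_zero, map_add, map_sub, map_sum, map_mul,
      Complex.conj_ofReal]
    congr 2
    split_ifs <;> simp
  have hcorr : ∀ m : ℕ, ∑ i, (p i : ℂ) * (conj (h i) * act (M ^ m) h i) = c m := by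
    intro m
    refine (sum_conj_mul_pow_mulVec hM_stochastic hpos hp_prob hp_stationary h m).trans ?_
    rw [hbraket]
    simp only [hc, hd, Int.natAbs_natCast, Nat.cast_eq_zero, hA]
    push_cast
    split_ifs <;> ring
  -- Countably many lags `m` leave a single exceptional null set.
  have hae : ∀ᵐ ω ∂P, ∀ m : ℕ, Tendsto (fun N : ℕ => ((N : ℝ) : ℂ)⁻¹ *
      ∑ k ∈ Finset.Icc (-(N : ℤ)) (N - m), η (k + m) ω * conj (η k ω)) atTop (𝓝 (2 * c m)) :=
    ae_all_iff.2 fun m =>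
      hη.ae_tendsto_correlation hh hp_prob hM_stochastic hK hr hr1 hKr m (hcorr m)
  filter_upwards [hae] with ω hω
  have hac : acPart (combAddDensity A f) = _ := acPart_combAddDensity A hcont
  have hA0 : 0 ≤ A := by positivity
  have hcd : ∀ m, c m = A + d m := fun _ => rfl
  have hnat := CMeasure.isNaturalAutocorrelation_weightedComb (w := fun m => η m ω) hc_conj hω
  refine ⟨combAddDensity A f, ?_, ?_, hac⟩
  · exact CMeasure.isDiffraction_combAddDensity hA0 hnat hcd hd_summable hcont hnonneg hC hdsum
  · rw [hac]
    rfl
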